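/- Let $d\in\mathbb N$, $p\in(1,\infty)$, and let $(\Omega,\mathcal F,P)$ be a separable probability space with expectation $\langle\cdot\rangle$ and a measure-preserving action $(T_x)_{x\in\mathbb Z^d}$: each $T_x:\Omega\to\Omega$ is measurable and preserves $P$, $T_0=\mathrm{Id}$ and $T_{x+y}=T_x\circ T_y$. *Notation.* For $\varepsilon>0$ let $m_\varepsilon=\varepsilon^d\sum_{x\in\varepsilon\mathbb Z^d}\delta_x$, let $L^p(\Omega\times\varepsilon\mathbb Z^d)$ be taken with respect to $P\otimes m_\varepsilon$, and set $\nabla^\varepsilon_i u(\omega,x)=\varepsilon^{-1}\big(u(\omega,x+\varepsilon e_i)-u(\omega,x)\big)$, $\nabla^\varepsilon u=(\nabla^\varepsilon_1u,\dots,\nabla^\varepsilon_du)$. For $x\in\mathbb R^d$ let $\lfloor x\rfloor_\varepsilon\in\varepsilon\mathbb Z^d$ be given by $x-\lfloor x\rfloor_\varepsilon\in\varepsilon[-\tfrac12,\tfrac12)^d$, and define the unfolding $\mathcal T_\varepsilon u(\omega,x)=u\big(T_{-\lfloor x\rfloor_\varepsilon/\varepsilon}\,\omega,\lfloor x\rfloor_\varepsilon\big)$.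 We write $u_\varepsilon\overset{2}{\rightharpoonup}U$ if $\mathcal T_\varepsilon u_\varepsilon\rightharpoonup U$ weakly in $L^p(\Omega\times\mathbb R^d)$; for vector fields this is meant componentwise. Let $D\varphi=(D_1\varphi,\dots,D_d\varphi)$ with $D_i\varphi(\omega)=\varphi(T_{e_i}\omega)-\varphi(\omega)$ (acting in the variable $\omega$ on functions on $\Omega\times\mathbb R^d$), let $L^p_{\mathsf{inv}}(\Omega)=\{\varphi\in L^p(\Omega):\varphi\circ T_x=\varphi \text{ a.e. for all }x\in\mathbb Z^d\}$, and let $\mathbf L^p_{\mathsf{pot}}(\Omega)$ be the closure of $\{D\varphi:\varphi\in L^p(\Omega)\}$ in $L^p(\Omega)^d$. Finally $X\otimes Y$ denotes the closure of the linear span of the products $\varphi(\omega)\eta(x)$, $\varphi\in X$, $\eta\in Y$: in $L^p(\Omega\times\mathbb R^d)$ (respectively $L^p(\Omega\times\mathbb R^d)^d$) if $Y=L^p(\mathbb R^d)$, and in $L^p(\Omega;W^{1,p}(\mathbb R^d))$ if $Y=W^{1,p}(\mathbb R^d)$; in the latter case $\nabla U$ is the weak gradient in $x$. **Proposition (Compactness).**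 Let $\gamma\ge0$, let $\varepsilon$ run through a sequence of positive numbers tending to $0$, and let $u_\varepsilon\in L^p(\Omega\times\varepsilon\mathbb Z^d)$ satisfy $$\limsup_{\varepsilon\to0}\Big\langle\int_{\varepsilon\mathbb Z^d}|u_\varepsilon(\omega,x)|^p+\varepsilon^{\gamma p}|\nabla^\varepsilon u_\varepsilon(\omega,x)|^p\,dm_\varepsilon(x)\Big\rangle<\infty .$$ 1. If $\gamma=0$, there exist $U\in L^p_{\mathsf{inv}}(\Omega)\otimes W^{1,p}(\mathbb R^d)$ and $\chi\in\mathbf L^p_{\mathsf{pot}}(\Omega)\otimes L^p(\mathbb R^d)$ such that, up to a subsequence, $u_\varepsilon\overset{2}{\rightharpoonup}U$ and $\nabla^\varepsilon u_\varepsilon\overset{2}{\rightharpoonup}\nabla U+\chi$. 2. If $\gamma\in(0,1)$, there exist $U\in L^p_{\mathsf{inv}}(\Omega)\otimes L^p(\mathbb R^d)$ and $\chi\in\mathbf L^p_{\mathsf{pot}}(\Omega)\otimes L^p(\mathbb R^d)$ such that, up to a subsequence, $u_\varepsilon\overset{2}{\rightharpoonup}U$ and $\varepsilon^\gamma\nabla^\varepsilon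 u_\varepsilon\overset{2}{\rightharpoonup}\chi$. 3. If $\gamma=1$, there exists $U\in L^p(\Omega\times\mathbb R^d)$ such that, up to a subsequence, $u_\varepsilon\overset{2}{\rightharpoonup}U$ and $\varepsilon\nabla^\varepsilon u_\varepsilon\overset{2}{\rightharpoonup}DU$. 4. If $\gamma>1$, there exists $U\in L^p(\Omega\times\mathbb R^d)$ such that, up to a subsequence, $u_\varepsilon\overset{2}{\rightharpoonup}U$ and $\varepsilon^\gamma\nabla^\varepsilon u_\varepsilon\overset{2}{\rightharpoonup}0$. -/

import Mathlib

open MeasureTheory Filter Topology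
open scoped ENNReal

noncomputable section

namespace StochasticUnfolding

/-- The physical space `ℝ^d` with its Euclidean structure. -/
abbrev Space (d : ℕ) : Type := EuclideanSpace ℝ (Fin d)

/-- The lattice `ℤ^d`. A point `x = ε z` of `ε ℤ^d` (`ε > 0`) is represented by its index `z ∈ ℤ^d`;
a function `v` on `ε ℤ^d` is represented by `z ↦ v (ε z)`. -/
abbrev Lattice (d : ℕ) : Type := Fin d → ℤ

/-- The unit vector `e_i` of `ℤ^d`. -/
def unitVec {d : ℕ} (i : Fin d) : Lattice d := Pi.single i 1

/-- The rescaled counting measure `m_ε = ε^d ∑_{x ∈ ε ℤ^d} δ_x`, in terms of the indices. -/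
def latticeMeasure (d : ℕ) (ε : ℝ) : Measure (Lattice d) :=
  ENNReal.ofReal (ε ^ d) • Measure.count

/-- The index `z` of the lattice point `⌊x⌋_ε = ε z`, which is characterized by
`x - ε z ∈ ε [-1/2, 1/2)^d`. -/
def roundIndex {d : ℕ} (ε : ℝ) (x : Space d) : Lattice d := fun i => ⌊x i / ε + 1 / 2⌋

theorem sub_roundIndex_mem {d : ℕ} {ε : ℝ} (hε : 0 < ε) (x : Space d) (i : Fin d) :
    x i - ε * (roundIndex ε x i : ℝ) ∈ Set.Ico (-(ε / 2)) (ε / 2) := by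
  have h1 := Int.floor_le (x i / ε + 1 / 2)
  have h2 := Int.lt_floor_add_one (x i / ε + 1 / 2)
  have h3 : ε * (x i / ε) = x i := by field_simp
  unfold roundIndex
  constructor <;> nlinarith

section Dynamics

variable {Ω : Type*} {d : ℕ} [AddAction (Lattice d) Ω]

/-- The `i`-th component `∇^ε_i u (ω, x) = (u (ω, x + ε e_i) - u (ω, x)) / ε` of the discrete
gradient of a random field on `ε ℤ^d`. -/
def discreteDeriv (ε : ℝ) (i : Fin d) (u : Ω × Lattice d → ℝ) : Ω × Lattice d → ℝ :=
  fun z => (u (z.1, z.2 + unitVec i) - u z) / ε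

/-- The discrete gradient `∇^ε u = (∇^ε_1 u, …, ∇^ε_d u)`, with values in Euclidean space. -/
def discreteGrad (ε : ℝ) (u : Ω × Lattice d → ℝ) (z : Ω × Lattice d) : Space d :=
  WithLp.toLp 2 fun i => discreteDeriv ε i u z

/-- The stochastic unfolding `(𝒯_ε u) (ω, x) = u (T_{-⌊x⌋_ε / ε} ω, ⌊x⌋_ε)`: the unfolding on the
lattice followed by piecewise constant interpolation. The dynamical system is written as an action,
`T_z ω = z +ᵥ ω`. -/
def unfold (ε : ℝ) (u : Ω × Lattice d → ℝ) : Ω × Space d → ℝ :=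
  fun z => u (-(roundIndex ε z.2) +ᵥ z.1, roundIndex ε z.2)

end Dynamics

section Spaces

variable {Ω : Type*} [MeasurableSpace Ω] {d : ℕ} (P : Measure Ω)
  (p : ℝ≥0∞) [Fact (1 ≤ p)]

/-- `L^p(Ω × ℝ^d)`. -/
abbrev LpField (d : ℕ) (P : Measure Ω) (p : ℝ≥0∞) : Type _ :=
  Lp ℝ p (P.prod (volume : Measure (Space d)))

/-- `⟨∫_{ε ℤ^d} |u|^p + ε^{γ p} |∇^ε u|^p dm_ε⟩`, as an extended nonnegative number. -/
def energy {d : ℕ} (P : Measure Ω) (p : ℝ≥0∞) (γ ε : ℝ) (u : Ω × Lattice d → ℝ) : ℝ≥0∞ :=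
  ∫⁻ ω, ∫⁻ z, ENNReal.ofReal (|u (ω, z)| ^ p.toReal
    + ε ^ (γ * p.toReal) * ‖discreteGrad ε u (ω, z)‖ ^ p.toReal) ∂(latticeMeasure d ε) ∂P

/-- Weak stochastic two-scale convergence in the mean of `u_n ∈ L^p(Ω × ε_n ℤ^d)` to
`U ∈ L^p(Ω × ℝ^d)`: the unfoldings `𝒯_{ε_n} u_n` belong to `L^p(Ω × ℝ^d)` and converge weakly
in this Banach space to `U`. -/
def WeakTwoScale [AddAction (Lattice d) Ω] (ε : ℕ → ℝ) (u : ℕ → Ω × Lattice d → ℝ)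
    (U : LpField d P p) : Prop :=
  ∃ h : ∀ n, MemLp (unfold (ε n) (u n)) p (P.prod volume),
    ∀ ℓ : LpField d P p →L[ℝ] ℝ,
      Tendsto (fun n => ℓ ((h n).toLp (unfold (ε n) (u n)))) atTop (𝓝 (ℓ U))

section Shift

variable [AddAction (Lattice d) Ω] [MeasurableConstVAdd (Lattice d) Ω]
  [VAddInvariantMeasure (Lattice d) Ω P]

/-- The operator `φ ↦ φ ∘ T_z` on `L^p(Ω)`. -/
def shift (z : Lattice d) : Lp ℝ p P →ₗ[ℝ] Lp ℝ p P :=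
  Lp.compMeasurePreservingₗ ℝ (fun ω : Ω => z +ᵥ ω) (measurePreserving_vadd z P)

/-- The operator `U ↦ ((ω, x) ↦ U (T_z ω, x))` on `L^p(Ω × ℝ^d)`. -/
def shiftField [SFinite P] (z : Lattice d) : LpField d P p →ₗ[ℝ] LpField d P p :=
  Lp.compMeasurePreservingₗ ℝ (Prod.map (fun ω : Ω => z +ᵥ ω) id)
    ((measurePreserving_vadd z P).prod (MeasurePreserving.id volume))

/-- The horizontal derivative `D φ = (φ ∘ T_{e_i} - φ)_i` on `L^p(Ω)`. -/
def horizontalGrad : Lp ℝ p P →ₗ[ℝ] (Fin d → Lp ℝ p P) :=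
  LinearMap.pi fun i => shift P p (unitVec i) - LinearMap.id

/-- The horizontal derivative `D_i U (ω, x) = U (T_{e_i} ω, x) - U (ω, x)` on `L^p(Ω × ℝ^d)`. -/
def horizontalDerivField [SFinite P] (i : Fin d) : LpField d P p →ₗ[ℝ] LpField d P p :=
  shiftField P p (unitVec i) - LinearMap.id

variable (d)

/-- The space `L^p_inv(Ω)` of shift-invariant functions. -/
def LpInv : Submodule ℝ (Lp ℝ p P) :=
  ⨅ z : Lattice d, LinearMap.eqLocus (shift P p z) LinearMap.id

/-- The space `L^p_pot(Ω)`: the closure of the range of `D` in `L^p(Ω)^d`. -/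
def LpPot : Submodule ℝ (Fin d → Lp ℝ p P) :=
  (LinearMap.range (horizontalGrad (d := d) P p)).topologicalClosure

end Shift

/-- `F ∈ L^p(Ω × ℝ^d)` is the product `(ω, x) ↦ φ ω * η x`. -/
def IsTensor {P : Measure Ω} {p : ℝ≥0∞} (φ : Lp ℝ p P)
    (η : Lp ℝ p (volume : Measure (Space d))) (F : LpField d P p) : Prop :=
  F =ᵐ[P.prod volume] fun z => φ z.1 * η z.2

/-- `g = (g_1, …, g_d) ∈ L^p(ℝ^d)^d` is the weak gradient of `u ∈ L^p(ℝ^d)`. -/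
def IsWeakGrad {p : ℝ≥0∞} (u : Lp ℝ p (volume : Measure (Space d)))
    (g : Fin d → Lp ℝ p (volume : Measure (Space d))) : Prop :=
  ∀ (i : Fin d) (ψ : Space d → ℝ), ContDiff ℝ (⊤ : ℕ∞) ψ → HasCompactSupport ψ →
    ∫ x, u x * fderiv ℝ ψ x (EuclideanSpace.single i 1) = - ∫ x, g i x * ψ x

section Tensor

variable (d) [AddAction (Lattice d) Ω] [MeasurableConstVAdd (Lattice d) Ω]
  [VAddInvariantMeasure (Lattice d) Ω P]

/-- `L^p_inv(Ω) ⊗ L^p(ℝ^d)`: the closure in `L^p(Ω × ℝ^d)` of the span of the products `φ η`. -/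
def invTensorLp : Submodule ℝ (LpField d P p) :=
  (Submodule.span ℝ {F | ∃ φ ∈ LpInv d P p, ∃ η : Lp ℝ p (volume : Measure (Space d)),
    IsTensor φ η F}).topologicalClosure

/-- `L^p_pot(Ω) ⊗ L^p(ℝ^d)`: the closure in `L^p(Ω × ℝ^d)^d` of the span of the products `χ η`. -/
def potTensorLp : Submodule ℝ (Fin d → LpField d P p) :=
  (Submodule.span ℝ {F | ∃ χ ∈ LpPot d P p, ∃ η : Lp ℝ p (volume : Measure (Space d)),
    ∀ i, IsTensor (χ i) η (F i)}).topologicalClosure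

/-- `L^p_inv(Ω) ⊗ W^{1,p}(ℝ^d)`: the closure of the span of the products `φ η` with
`φ ∈ L^p_inv(Ω)`, `η ∈ W^{1,p}(ℝ^d)`, in `L^p(Ω; W^{1,p}(ℝ^d))`.
A function `w ∈ W^{1,p}(ℝ^d)` is represented by the pair `(w, ∇ w)` and accordingly an element
`U` of `L^p(Ω; W^{1,p}(ℝ^d))` by the pair `(U, ∇ U)` in `L^p(Ω × ℝ^d) × L^p(Ω × ℝ^d)^d`; the norm
of `U` in `L^p(Ω; W^{1,p}(ℝ^d))` is (equivalent to) the norm of this pair. So `(U, G)` is in the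
space below if and only if `U ∈ L^p_inv(Ω) ⊗ W^{1,p}(ℝ^d)` and `G = ∇ U`. -/
def invTensorSobolev : Submodule ℝ (LpField d P p × (Fin d → LpField d P p)) :=
  (Submodule.span ℝ {F | ∃ φ ∈ LpInv d P p, ∃ (η : Lp ℝ p (volume : Measure (Space d)))
    (g : Fin d → Lp ℝ p (volume : Measure (Space d))), IsWeakGrad η g ∧
      IsTensor φ η F.1 ∧ ∀ i, IsTensor φ (g i) (F.2 i)}).topologicalClosure

end Tensor

end Spaces

end StochasticUnfolding

end

open StochasticUnfolding

/-! Write `v_n` for the unfolding of `u_n`, `S_i` for the shift by `e_i` in `ω`, and `τ_h` for the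
translation by `h` in `x`. The unfolding is norm preserving and turns the `i`-th discrete derivative
into `ε⁻¹ (S_i τ_{ε e_i} v - v)` (`unfold_discreteDeriv`). What remains is a statement about a
bounded sequence in a Banach space carrying commuting contractions `S_i` and a translation group
that commutes with them. Weak compactness gives limits `U` of `v_n` and `W_i` of `ε^γ ε⁻¹ (S_i τ_{ε
e_i} v - v)`.

Split `S_i τ v - v = S_i (τ - 1) v + (S_i - 1) v`. After mollification in `x` by an operator `M`,
`ε⁻¹ (τ_{ε e_i} - 1) M` converges in operator norm (`tendsto_mollify_diffQuot`), so the slow part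
passes to the weak limit. This gives `W_i = S_i U - U` for `γ = 1`. For `γ > 1` the derivatives
vanish in norm. For `γ < 1` the bound forces `S_i τ v - v → 0`, so `U` is shift invariant.

For `γ < 1` the fast part `ε⁻¹ (S_i - 1) M v` is singular, but a family `ℓ` of functionals with `∑
ℓ_i ∘ (S_i - 1) = 0` does not see it (`sum_dual_mollify_eq`). If `γ > 0`, the prefactor `ε^γ` also
removes the slow part, so every such `ℓ` annihilates `W`, and Hahn-Banach puts `W` in the potential
space (`mem_potTensorLp`). If `γ = 0`, let `G_i` be the invariant part of `W_i` in the mean ergodic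
decomposition. Testing with one invariant functional in a single component identifies `G` as the
gradient of `U`, and testing with all admissible `ℓ` then shows that `W - G` is potential
(`exists_gradient_splitting`).

The abstract fixed space is identified with the closure of invariant tensors by the mean ergodic
decomposition (`fixedSpace_le_invTensorLp`), and the Sobolev version follows by mollifying
(`mem_invTensorSobolev`). Weak compactness of `L^p` comes from the duality of `L^p` and `L^q` and
weak-* sequential compactness over the separable space `L^q`. -/

noncomputable section

namespace StochasticUnfolding

/-! ### Weak convergence of sequences -/

section Weak

variable {X Y : Type*} [NormedAddCommGroup X] [NormedSpace ℝ X]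
  [NormedAddCommGroup Y] [NormedSpace ℝ Y]

/-- Weak convergence of a sequence in a normed space. -/
def WeakTendsto (x : ℕ → X) (a : X) : Prop :=
  ∀ ℓ : X →L[ℝ] ℝ, Tendsto (fun n => ℓ (x n)) atTop (𝓝 (ℓ a))

/-- Every bounded sequence has a weakly convergent subsequence. -/
def HasWeakCompactness (X : Type*) [NormedAddCommGroup X] [NormedSpace ℝ X] : Prop :=
  ∀ (C : ℝ) (x : ℕ → X), (∀ n, ‖x n‖ ≤ C) →
    ∃ (a : X) (k : ℕ → ℕ), StrictMono k ∧ WeakTendsto (x ∘ k) a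

/-- A closed subspace is cut out by the functionals vanishing on it. -/
theorem mem_of_forall_dual_eq_zero {M : Submodule ℝ X} (hM : IsClosed (M : Set X)) {x : X}
    (h : ∀ ℓ : X →L[ℝ] ℝ, (∀ y ∈ M, ℓ y = 0) → ℓ x = 0) : x ∈ M := by
  by_contra hx
  obtain ⟨f, u, hf, hu⟩ := geometric_hahn_banach_closed_point M.convex hM hx
  have h0 : ∀ y ∈ M, f y = 0 := by
    intro y hy
    by_contra hne
    -- This multiple of `y` takes the value `u` exactly, while `f < u` on `M`.
    have := hf ((u / f y) • y) (M.smul_mem _ hy)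
    rw [map_smul, smul_eq_mul, div_mul_cancel₀ _ hne] at this
    exact lt_irrefl _ this
  have h1 := hf 0 M.zero_mem
  rw [map_zero] at h1
  rw [h f h0] at hu
  exact lt_asymm h1 hu

theorem eq_of_forall_dual_eq {x y : X} (h : ∀ ℓ : X →L[ℝ] ℝ, ℓ x = ℓ y) : x = y := by
  refine sub_eq_zero.1 <| (Submodule.mem_bot ℝ).1 <|
    mem_of_forall_dual_eq_zero (M := ⊥) (by simp) fun ℓ _ => ?_
  rw [map_sub, h, sub_self]

namespace WeakTendsto

variable {x y : ℕ → X} {a b : X}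

theorem unique (ha : WeakTendsto x a) (hb : WeakTendsto x b) : a = b :=
  eq_of_forall_dual_eq fun ℓ => tendsto_nhds_unique (ha ℓ) (hb ℓ)

theorem of_tendsto (h : Tendsto x atTop (𝓝 a)) : WeakTendsto x a :=
  fun ℓ => (ℓ.continuous.tendsto a).comp h

theorem map (h : WeakTendsto x a) (T : X →L[ℝ] Y) : WeakTendsto (fun n => T (x n)) (T a) :=
  fun ℓ => h (ℓ.comp T)

theorem add (hx : WeakTendsto x a) (hy : WeakTendsto y b) :
    WeakTendsto (fun n => x n + y n) (a + b) := fun ℓ => by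
  simpa only [map_add] using (hx ℓ).add (hy ℓ)

theorem sub (hx : WeakTendsto x a) (hy : WeakTendsto y b) :
    WeakTendsto (fun n => x n - y n) (a - b) := fun ℓ => by
  simpa only [map_sub] using (hx ℓ).sub (hy ℓ)

theorem subseq (hx : WeakTendsto x a) {k : ℕ → ℕ} (hk : StrictMono k) : WeakTendsto (x ∘ k) a :=
  fun ℓ => (hx ℓ).comp hk.tendsto_atTop

theorem mem (hx : WeakTendsto x a) {M : Submodule ℝ X} (hM : IsClosed (M : Set X))
    (h : ∀ n, x n ∈ M) : a ∈ M :=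
  mem_of_forall_dual_eq_zero hM fun ℓ hℓ =>
    tendsto_nhds_unique (hx ℓ) (by simp only [hℓ _ (h _), tendsto_const_nhds])

/-- Norm convergent operators preserve weak convergence of bounded sequences. -/
theorem clm_apply (hx : WeakTendsto x a) {C : ℝ} (hC : ∀ n, ‖x n‖ ≤ C) {T : ℕ → X →L[ℝ] Y}
    {T' : X →L[ℝ] Y} (hT : Tendsto T atTop (𝓝 T')) :
    WeakTendsto (fun n => T n (x n)) (T' a) := by
  have h0 : Tendsto (fun n => (T n - T') (x n)) atTop (𝓝 0) := by
    refine squeeze_zero_norm (a := fun n => ‖T n - T'‖ * C) (fun n => ?_) ?_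
    · exact ((T n - T').le_opNorm _).trans (by gcongr; exact hC n)
    · simpa using (tendsto_iff_norm_sub_tendsto_zero.1 hT).mul_const C
  simpa using (of_tendsto h0).add (hx.map T')

end WeakTendsto

theorem HasWeakCompactness.exists_common_subseq (hX : HasWeakCompactness X) {ι : Type*}
    (s : Finset ι) {C : ℝ} {x : ι → ℕ → X} (hx : ∀ i n, ‖x i n‖ ≤ C) :
    ∃ k : ℕ → ℕ, StrictMono k ∧ ∃ a : ι → X, ∀ i ∈ s, WeakTendsto (x i ∘ k) (a i) := by
  classical
  induction s using Finset.induction_on with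
  | empty => exact ⟨id, strictMono_id, 0, by simp⟩
  | insert j s hj ih =>
    obtain ⟨k, hk, a, ha⟩ := ih
    obtain ⟨b, m, hm, hb⟩ := hX C (x j ∘ k) fun n => hx j _
    refine ⟨k ∘ m, hk.comp hm, Function.update a j b, fun i hi => ?_⟩
    rcases Finset.mem_insert.1 hi with rfl | hi
    · rw [Function.update_self]
      exact hb
    · rw [Function.update_of_ne (ne_of_mem_of_not_mem hi hj)]
      exact (ha i hi).subseq hm

end Weak

/-! ### The mean ergodic decomposition for commuting contractions -/

section MeanErgodic

variable {X : Type*} [NormedAddCommGroup X] [NormedSpace ℝ X] {ι : Type*}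

/-- The common fixed vectors of a family of operators. -/
def fixedSpace (S : ι → X →L[ℝ] X) : Submodule ℝ X :=
  ⨅ i, LinearMap.ker (S i - 1 : X →L[ℝ] X).toLinearMap

/-- The span of the ranges of the operators `S i - 1`. -/
def coboundarySpan (S : ι → X →L[ℝ] X) : Submodule ℝ X :=
  ⨆ i, LinearMap.range (S i - 1 : X →L[ℝ] X).toLinearMap

variable {S : ι → X →L[ℝ] X}

theorem mem_fixedSpace {x : X} : x ∈ fixedSpace S ↔ ∀ i, S i x = x := by
  simp [fixedSpace, Submodule.mem_iInf, sub_eq_zero]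

theorem isClosed_fixedSpace : IsClosed (fixedSpace S : Set X) := by
  simp only [fixedSpace, Submodule.coe_iInf]
  exact isClosed_iInter fun i => (S i - 1 : X →L[ℝ] X).isClosed_ker

theorem sub_mem_coboundarySpan (i : ι) (x : X) : S i x - x ∈ coboundarySpan S :=
  (le_iSup (fun i => LinearMap.range (S i - 1 : X →L[ℝ] X).toLinearMap) i) ⟨x, by simp⟩

theorem coboundarySpan_le {M : Submodule ℝ X} (h : ∀ i x, S i x - x ∈ M) :
    coboundarySpan S ≤ M := by
  refine iSup_le fun i => ?_
  rintro _ ⟨x, rfl⟩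
  simpa using h i x

/-- Vectors annihilated by all invariant functionals are limits of coboundaries. -/
theorem mem_closure_coboundarySpan {x : X}
    (h : ∀ ℓ : X →L[ℝ] ℝ, (∀ i y, ℓ (S i y) = ℓ y) → ℓ x = 0) :
    x ∈ (coboundarySpan S).topologicalClosure := by
  refine mem_of_forall_dual_eq_zero (Submodule.isClosed_topologicalClosure _) fun ℓ hℓ =>
    h ℓ fun i y => ?_
  rw [← sub_eq_zero, ← map_sub]
  exact hℓ _ (Submodule.le_topologicalClosure _ (sub_mem_coboundarySpan i y))

/-- Averages of a finite commuting family of contractions that almost annihilate the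
coboundaries. -/
theorem exists_averaging (hcomm : ∀ i j, Commute (S i) (S j)) (hS : ∀ i, ‖S i‖ ≤ 1)
    {δ : ℝ} (hδ : 0 < δ) (s : Finset ι) :
    ∃ A : X →L[ℝ] X, ‖A‖ ≤ 1 ∧ (∀ i, Commute A (S i)) ∧ (∀ x, A x - x ∈ coboundarySpan S) ∧
      (∀ x ∈ fixedSpace S, A x = x) ∧ ∀ i ∈ s, ‖A * (S i - 1)‖ ≤ δ := by
  classical
  induction s using Finset.induction_on with
  | empty => exact ⟨1, ContinuousLinearMap.norm_id_le, fun i => Commute.one_left _, by simp,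
      by simp, by simp⟩
  | insert j s hj ih =>
    obtain ⟨A, hA, hAS, hAx, hAf, hAs⟩ := ih
    -- The 2 bounds `‖S j ^ N - 1‖`, which is what the Cesàro mean of length `N` leaves, divided by
    -- `N`, after telescoping against `S j - 1`.
    obtain ⟨N, hN⟩ := exists_nat_gt (2 / δ)
    have hN0 : (0 : ℝ) < N := lt_trans (by positivity) hN
    have hpow : ∀ k, ‖S j ^ k‖ ≤ 1 := fun k => by
      rcases Nat.eq_zero_or_pos k with rfl | hk
      · exact ContinuousLinearMap.norm_id_le
      · exact (norm_pow_le' _ hk).trans (pow_le_one₀ (norm_nonneg _) (hS j))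
    set B : X →L[ℝ] X := (N : ℝ)⁻¹ • ∑ k ∈ Finset.range N, S j ^ k with hB
    have hBn : ‖B‖ ≤ 1 := by
      rw [hB, norm_smul, norm_inv, Real.norm_natCast, inv_mul_le_iff₀ hN0]
      refine (norm_sum_le _ _).trans ((Finset.sum_le_sum fun k _ => hpow k).trans ?_)
      simp
    have hcB : ∀ T : X →L[ℝ] X, Commute T (S j) → Commute T B := fun T hT =>
      (Commute.sum_right _ _ _ fun k _ => hT.pow_right k).smul_right _
    have hBx : ∀ x, B x - x ∈ coboundarySpan S := by
      intro x
      have : B x - x = (N : ℝ)⁻¹ • ∑ k ∈ Finset.range N, ((S j ^ k) x - x) := by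
        rw [Finset.sum_sub_distrib, smul_sub]
        simp [hB, ← Nat.cast_smul_eq_nsmul ℝ, smul_smul, hN0.ne']
      rw [this]
      refine Submodule.smul_mem _ _ (Submodule.sum_mem _ fun k hk => ?_)
      clear hk
      induction k with
      | zero => simp
      | succ k ihk =>
        rw [pow_succ']
        have := Submodule.add_mem _ (sub_mem_coboundarySpan (S := S) j ((S j ^ k) x)) ihk
        simpa using this
    have hBf : ∀ x ∈ fixedSpace S, B x = x := by
      intro x hx
      have hk : ∀ k, (S j ^ k) x = x := fun k => by
        induction k with
        | zero => simp
        | succ k ihk => rw [pow_succ', mul_apply_eq_comp, ihk, mem_fixedSpace.1 hx]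
      simp [hB, hk, ← Nat.cast_smul_eq_nsmul ℝ, smul_smul, hN0.ne']
    have hBj : ‖B * (S j - 1)‖ ≤ δ := by
      have : B * (S j - 1) = (N : ℝ)⁻¹ • (S j ^ N - 1) := by
        rw [hB, smul_mul_assoc, geom_sum_mul]
      rw [this, norm_smul, norm_inv, Real.norm_natCast, inv_mul_le_iff₀ hN0]
      have h2 : ‖S j ^ N - 1‖ ≤ 2 :=
        (norm_sub_le _ _).trans (by
          have := hpow N
          have : ‖(1 : X →L[ℝ] X)‖ ≤ 1 := ContinuousLinearMap.norm_id_le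
          linarith [hpow N])
      rw [div_lt_iff₀ hδ] at hN
      linarith
    -- The factors commute, so the one that almost kills `S i - 1` can be put next to it; the other
    -- is a contraction.
    refine ⟨A * B, ?_, fun i => (hAS i).mul_left (hcB _ (hcomm i j)).symm, fun x => ?_,
      fun x hx => ?_, fun i hi => ?_⟩
    · exact (norm_mul_le _ _).trans (mul_le_one₀ hA (norm_nonneg _) hBn)
    · have := Submodule.add_mem _ (hAx (B x)) (hBx x)
      simpa using this
    · rw [mul_apply_eq_comp, hBf x hx, hAf x hx]
    · rcases Finset.mem_insert.1 hi with rfl | hi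
      · rw [mul_assoc]
        exact (norm_mul_le _ _).trans <| (mul_le_of_le_one_left (norm_nonneg _) hA).trans hBj
      · rw [(hcB A (hAS j)).eq, mul_assoc]
        exact (norm_mul_le _ _).trans <| (mul_le_of_le_one_left (norm_nonneg _) hBn).trans (hAs i hi)

variable [Fintype ι]

/-- Averages are contractions that fix `x` and make coboundaries arbitrarily small. Thus the sum of
the two spaces is direct, and the projection onto the fixed space has norm at most one. -/
theorem norm_le_norm_add_coboundary (hcomm : ∀ i j, Commute (S i) (S j)) (hS : ∀ i, ‖S i‖ ≤ 1)
    {x z : X} (hx : x ∈ fixedSpace S) (hz : z ∈ (coboundarySpan S).topologicalClosure) :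
    ‖x‖ ≤ ‖x + z‖ := by
  have hcl : IsClosed {z | ‖x‖ ≤ ‖x + z‖} :=
    isClosed_le continuous_const (by fun_prop)
  refine hcl.closure_subset_iff.2 ?_ hz
  intro z hz
  -- `C` depends only on a representation of `z` as a finite sum of coboundaries, not on the
  -- averaging `A`, so `δ` can be chosen afterwards.
  obtain ⟨C, hC0, hC⟩ : ∃ C : ℝ, 0 ≤ C ∧ ∀ (A : X →L[ℝ] X) (δ : ℝ),
      (∀ i, ‖A * (S i - 1)‖ ≤ δ) → 0 ≤ δ → ‖A z‖ ≤ δ * C := by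
    refine Submodule.iSup_induction _ (motive := fun z => ∃ C : ℝ, 0 ≤ C ∧
      ∀ (A : X →L[ℝ] X) (δ : ℝ), (∀ i, ‖A * (S i - 1)‖ ≤ δ) → 0 ≤ δ → ‖A z‖ ≤ δ * C) hz ?_ ?_ ?_
    · rintro i _ ⟨y, rfl⟩
      refine ⟨‖y‖, norm_nonneg _, fun A δ hA _ => ?_⟩
      exact ((A * (S i - 1)).le_opNorm y).trans (by gcongr; exact hA i)
    · exact ⟨0, le_rfl, by simp⟩
    · rintro a b ⟨C, hC0, hC⟩ ⟨D, hD0, hD⟩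
      refine ⟨C + D, by positivity, fun A δ hA hδ => ?_⟩
      rw [map_add, mul_add]
      exact (norm_add_le _ _).trans (add_le_add (hC A δ hA hδ) (hD A δ hA hδ))
  change ‖x‖ ≤ ‖x + z‖
  refine le_of_forall_pos_le_add fun η hη => ?_
  obtain ⟨A, hA, -, -, hAf, hAs⟩ :=
    exists_averaging hcomm hS (δ := η / (C + 1)) (by positivity) Finset.univ
  have h1 : ‖A z‖ ≤ η := by
    refine (hC A _ (fun i => hAs i (Finset.mem_univ i)) (by positivity)).trans ?_
    rw [div_mul_eq_mul_div, div_le_iff₀ (by positivity)]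
    nlinarith
  calc ‖x‖ = ‖A (x + z) - A z‖ := by rw [map_add, add_sub_cancel_right, hAf x hx]
    _ ≤ ‖A (x + z)‖ + ‖A z‖ := norm_sub_le _ _
    _ ≤ ‖x + z‖ + η := by
      gcongr
      exact (A.le_opNorm _).trans (mul_le_of_le_one_left (norm_nonneg _) hA)

theorem eq_zero_of_mem_fixedSpace_of_mem_closure (hcomm : ∀ i j, Commute (S i) (S j))
    (hS : ∀ i, ‖S i‖ ≤ 1) {x : X} (hx : x ∈ fixedSpace S)
    (hz : x ∈ (coboundarySpan S).topologicalClosure) : x = 0 := by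
  have := norm_le_norm_add_coboundary hcomm hS hx (Submodule.neg_mem _ hz)
  simpa using this

/-- The mean ergodic decomposition. -/
theorem exists_fixed_add_coboundary (hX : HasWeakCompactness X)
    (hcomm : ∀ i j, Commute (S i) (S j)) (hS : ∀ i, ‖S i‖ ≤ 1) (x : X) :
    ∃ a ∈ fixedSpace S, x - a ∈ (coboundarySpan S).topologicalClosure := by
  choose A hA hAS hAx _ hAs using fun n : ℕ =>
    exists_averaging hcomm hS (δ := 1 / ((n : ℝ) + 1)) (by positivity) Finset.univ
  -- The invariant part is a weak limit point of the averages. It is fixed because `(S i - 1) A_n x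
  -- = A_n (S i - 1) x → 0` in norm, and `x - A_n x` stays in a closed, hence weakly closed,
  -- subspace.
  obtain ⟨a, k, hk, ha⟩ := hX ‖x‖ (fun n => A n x) fun n =>
    ((A n).le_opNorm _).trans (mul_le_of_le_one_left (norm_nonneg _) (hA n))
  refine ⟨a, mem_fixedSpace.2 fun i => ?_, ?_⟩
  · have h0 : Tendsto (fun n => (S i - 1 : X →L[ℝ] X) (A n x)) atTop (𝓝 0) := by
      refine squeeze_zero_norm (a := fun n : ℕ => 1 / ((n : ℝ) + 1) * ‖x‖) (fun n => ?_) ?_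
      · have hc : (S i - 1) * A n = A n * (S i - 1) := by
          rw [sub_mul, mul_sub, (hAS n i).eq, one_mul, mul_one]
        rw [← mul_apply_eq_comp, hc]
        exact ((A n * (S i - 1)).le_opNorm x).trans
          (by gcongr; exact hAs n i (Finset.mem_univ i))
      · simpa using tendsto_one_div_add_atTop_nhds_zero_nat.mul_const ‖x‖
    have := (ha.map (S i - 1 : X →L[ℝ] X)).unique
      (WeakTendsto.of_tendsto (h0.comp hk.tendsto_atTop))
    simpa [sub_eq_zero] using this
  · have hw : WeakTendsto (fun n => x - A (k n) x) (x - a) :=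
      (WeakTendsto.of_tendsto tendsto_const_nhds).sub ha
    refine hw.mem (Submodule.isClosed_topologicalClosure _) fun n => ?_
    rw [← neg_sub]
    exact Submodule.neg_mem _ (Submodule.le_topologicalClosure _ (hAx _ x))

end MeanErgodic

/-! ### Mollification along a continuous group of isometries -/

section Mollify

variable {d : ℕ} {X Y : Type*} [NormedAddCommGroup X] [NormedSpace ℝ X]
  [NormedAddCommGroup Y] [NormedSpace ℝ Y]

/-- A strongly continuous representation of `ℝ^d` by contractions. -/
structure IsTranslationGroup (τ : Space d → X →L[ℝ] X) : Prop where
  zero : τ 0 = 1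
  add : ∀ a b, τ (a + b) = τ a * τ b
  norm_le : ∀ a x, ‖τ a x‖ ≤ ‖x‖
  continuous_apply : ∀ x, Continuous fun a => τ a x

variable {τ : Space d → X →L[ℝ] X} {σ : Space d → Y →L[ℝ] Y}

theorem IsTranslationGroup.integrable_smul (hτ : IsTranslationGroup τ) {ρ : Space d → ℝ}
    (hρ : Integrable ρ) (x : X) : Integrable fun h => ρ h • τ h x :=
  hρ.smul_bdd ‖x‖ (hτ.continuous_apply x).aestronglyMeasurable
    (ae_of_all _ fun h => hτ.norm_le h x)

/-- The operator `x ↦ ∫ ρ(h) τ_h x dh`. -/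
def mollify (hτ : IsTranslationGroup τ) {ρ : Space d → ℝ} (hρ : Integrable ρ) : X →L[ℝ] X :=
  LinearMap.mkContinuous
    { toFun := fun x => ∫ h, ρ h • τ h x
      map_add' := fun x y => by
        simp only [map_add, smul_add]
        exact integral_add (hτ.integrable_smul hρ x) (hτ.integrable_smul hρ y)
      map_smul' := fun c x => by
        simp only [map_smul, smul_comm _ c, RingHom.id_apply]
        exact integral_smul _ _ }
    (∫ h, ‖ρ h‖) fun x => by
      refine (norm_integral_le_integral_norm _).trans ?_
      rw [← integral_mul_const]
      refine integral_mono (hτ.integrable_smul hρ x).norm (hρ.norm.mul_const _) fun h => ?_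
      simp only [norm_smul]
      gcongr
      exact hτ.norm_le h x

theorem mollify_apply (hτ : IsTranslationGroup τ) {ρ : Space d → ℝ} (hρ : Integrable ρ) (x : X) :
    mollify hτ hρ x = ∫ h, ρ h • τ h x := rfl

theorem norm_mollify_le (hτ : IsTranslationGroup τ) {ρ : Space d → ℝ} (hρ : Integrable ρ) :
    ‖mollify hτ hρ‖ ≤ ∫ h, ‖ρ h‖ :=
  LinearMap.mkContinuous_norm_le _ (integral_nonneg fun _ => norm_nonneg _) _

/-- Bounded operators pass through the Bochner integral. This serves both for operators commuting
with translations and for `η ↦ φ ⊗ η`, which intertwines two different groups. -/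
theorem map_mollify [CompleteSpace X] [CompleteSpace Y] (hτ : IsTranslationGroup τ)
    (hσ : IsTranslationGroup σ)
    {ρ : Space d → ℝ} (hρ : Integrable ρ) (T : X →L[ℝ] Y) (hT : ∀ h x, T (τ h x) = σ h (T x))
    (x : X) : T (mollify hτ hρ x) = mollify hσ hρ (T x) := by
  rw [mollify_apply, mollify_apply, ← ContinuousLinearMap.integral_comp_comm _
    (hτ.integrable_smul hρ x)]
  simp only [map_smul, hT]

/-- The partial derivative `∂_i ρ`. -/
def partialDeriv (i : Fin d) (ρ : Space d → ℝ) : Space d → ℝ :=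
  fun h => fderiv ℝ ρ h (EuclideanSpace.single i 1)

/-- `C¹` functions with compact support. -/
structure IsMollifier (ρ : Space d → ℝ) : Prop where
  contDiff : ContDiff ℝ 1 ρ
  hasCompactSupport : HasCompactSupport ρ

namespace IsMollifier

variable {ρ : Space d → ℝ}

theorem integrable (hρ : IsMollifier ρ) : Integrable ρ :=
  hρ.contDiff.continuous.integrable_of_hasCompactSupport hρ.hasCompactSupport

theorem continuous_partialDeriv (hρ : IsMollifier ρ) (i : Fin d) :
    Continuous (partialDeriv i ρ) :=
  (hρ.contDiff.continuous_fderiv one_ne_zero).clm_apply continuous_const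

theorem integrable_partialDeriv (hρ : IsMollifier ρ) (i : Fin d) :
    Integrable (partialDeriv i ρ) :=
  (hρ.continuous_partialDeriv i).integrable_of_hasCompactSupport
    (hρ.hasCompactSupport.fderiv_apply ℝ _)

/-- Difference quotients of a `C¹` function with compact support are dominated by a multiple of
the indicator of a compact set. -/
theorem exists_diffQuot_bound (hρ : IsMollifier ρ) (i : Fin d) :
    ∃ (C : ℝ) (K : Set (Space d)), IsCompact K ∧ ∀ (t : ℝ) (h : Space d), |t| ≤ 1 →
      ‖t⁻¹ * (ρ (h + t • EuclideanSpace.single i 1) - ρ h)‖ ≤ K.indicator (fun _ => C) h := by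
  obtain ⟨C, hC⟩ := (hρ.continuous_partialDeriv i).bounded_above_of_compact_support
    (hρ.hasCompactSupport.fderiv_apply ℝ _)
  -- A displacement with `|t| ≤ 1` moves the support by at most 1.
  refine ⟨C, Metric.cthickening 1 (tsupport ρ), hρ.hasCompactSupport.isCompact.cthickening,
    fun t h ht => ?_⟩
  have hn : ‖t • (EuclideanSpace.single i 1 : Space d)‖ ≤ 1 := by
    rw [norm_smul]; simpa using ht
  by_cases hK : h ∈ Metric.cthickening 1 (tsupport ρ)
  · rw [Set.indicator_of_mem hK]
    set f : ℝ → ℝ := fun s => ρ (h + s • EuclideanSpace.single i 1) with hf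
    have hd : ∀ s, HasDerivAt f (partialDeriv i ρ (h + s • EuclideanSpace.single i 1)) s := by
      intro s
      have h1 := ((hρ.contDiff.differentiable one_ne_zero)
        (h + s • (EuclideanSpace.single i 1 : Space d))).hasFDerivAt
      have h2 : HasDerivAt (fun s : ℝ => h + s • (EuclideanSpace.single i 1 : Space d))
          (EuclideanSpace.single i 1) s := by
        simpa using ((hasDerivAt_id s).smul_const
          (EuclideanSpace.single i 1 : Space d)).const_add h
      exact h1.comp_hasDerivAt s h2
    have hm := Convex.norm_image_sub_le_of_norm_hasDerivWithin_le (s := Set.univ) (x := 0) (y := t)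
      (fun s _ => (hd s).hasDerivWithinAt) (fun s _ => hC _) convex_univ trivial trivial
    have h0 : f 0 = ρ h := by simp [hf]
    have hC0 : 0 ≤ C := (norm_nonneg _).trans (hC 0)
    rw [norm_mul, norm_inv]
    rw [h0, sub_zero] at hm
    rcases eq_or_ne t 0 with rfl | ht0
    · simpa using hC0
    · rw [inv_mul_le_iff₀ (norm_pos_iff.2 ht0), mul_comm]
      exact hm
  · rw [Set.indicator_of_notMem hK]
    have h1 : ρ h = 0 := by
      by_contra hne
      exact hK (Metric.self_subset_cthickening _ (subset_tsupport _ hne))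
    have h2 : ρ (h + t • EuclideanSpace.single i 1) = 0 := by
      by_contra hne
      refine hK (Metric.mem_cthickening_of_dist_le h _ 1 _ (subset_tsupport _ hne) ?_)
      rw [dist_eq_norm]
      simpa using hn
    simp [h1, h2]

theorem tendsto_diffQuot (hρ : IsMollifier ρ) (i : Fin d) {t : ℕ → ℝ} (ht : Tendsto t atTop (𝓝 0))
    (ht0 : ∀ n, t n ≠ 0) (h : Space d) :
    Tendsto (fun n => (t n)⁻¹ * (ρ (h + t n • EuclideanSpace.single i 1) - ρ h)) atTop
      (𝓝 (partialDeriv i ρ h)) := by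
  have h1 := ((hρ.contDiff.differentiable one_ne_zero) h).hasFDerivAt.hasLineDerivAt
    (EuclideanSpace.single i 1)
  have h2 := (hasDerivAt_iff_tendsto_slope_zero.1 h1).comp
    (tendsto_nhdsWithin_iff.2 ⟨ht, Eventually.of_forall ht0⟩)
  simpa [Function.comp_def, partialDeriv] using h2

end IsMollifier

/-- A change of variables moves the difference quotient onto `ρ`, with the opposite sign, and the
`L¹` norm of a kernel bounds the operator norm. Convergence in operator norm, not merely pointwise,
is what `WeakTendsto.clm_apply` needs on a weakly convergent sequence. -/
theorem tendsto_mollify_diffQuot [CompleteSpace X] (hτ : IsTranslationGroup τ) {ρ : Space d → ℝ}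
    (hρ : IsMollifier ρ) (i : Fin d) {t : ℕ → ℝ} (ht : Tendsto t atTop (𝓝 0))
    (ht0 : ∀ n, t n ≠ 0) :
    Tendsto (fun n => (t n)⁻¹ • ((τ (t n • EuclideanSpace.single i 1) - 1) *
      mollify hτ hρ.integrable)) atTop (𝓝 (-mollify hτ (hρ.integrable_partialDeriv i))) := by
  set e : Space d := EuclideanSpace.single i 1
  -- The kernel of the error; its `L¹` norm tends to zero by dominated convergence.
  set q : ℕ → Space d → ℝ := fun n h => (t n)⁻¹ * (ρ (h + (-t n) • e) - ρ h) + partialDeriv i ρ h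
    with hq
  have hqi : ∀ n, Integrable (q n) := fun n =>
    (((hρ.integrable.comp_add_right _).sub hρ.integrable).const_mul _).add
      (hρ.integrable_partialDeriv i)
  have heq : ∀ n, (t n)⁻¹ • ((τ (t n • e) - 1) * mollify hτ hρ.integrable) -
      -mollify hτ (hρ.integrable_partialDeriv i) = mollify hτ (hqi n) := by
    intro n
    ext x
    have hs : τ (t n • e) (mollify hτ hρ.integrable x) = ∫ h, ρ (h + (-t n) • e) • τ h x := by
      rw [mollify_apply, ← ContinuousLinearMap.integral_comp_comm _
        (hτ.integrable_smul hρ.integrable x),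
        ← integral_add_right_eq_self (fun h => ρ (h + (-t n) • e) • τ h x) (t n • e)]
      refine integral_congr_ae (ae_of_all _ fun h => ?_)
      simp only [map_smul]
      rw [add_comm h, hτ.add]
      simp [add_comm]
    have hi1 := hτ.integrable_smul (hρ.integrable.comp_add_right ((-t n) • e)) x
    have hi2 := hτ.integrable_smul hρ.integrable x
    have hi3 := hτ.integrable_smul (hρ.integrable_partialDeriv i) x
    simp only [sub_apply, smul_apply,
      mul_apply_eq_comp, neg_apply,
      one_apply_eq_self, hs]
    rw [mollify_apply, mollify_apply, mollify_apply, ← integral_sub hi1 hi2, ← integral_smul,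
      sub_neg_eq_add, ← integral_add (f := fun h => (t n)⁻¹ • (ρ (h + -t n • e) • τ h x - ρ h • τ h x))
        ((hi1.sub hi2).smul (t n)⁻¹) hi3]
    refine integral_congr_ae (ae_of_all _ fun h => ?_)
    simp only [hq, add_smul, mul_smul, sub_smul]
  rw [tendsto_iff_norm_sub_tendsto_zero]
  simp only [heq]
  refine squeeze_zero (fun _ => norm_nonneg _) (fun n => norm_mollify_le hτ (hqi n)) ?_
  obtain ⟨C, K, hK, hb⟩ := hρ.exists_diffQuot_bound i
  have hlim : Tendsto (fun n => ∫ h, ‖q n h‖) atTop (𝓝 (∫ h : Space d, (0 : ℝ))) := by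
    refine tendsto_integral_filter_of_dominated_convergence
      (fun h => K.indicator (fun _ => C) h + ‖partialDeriv i ρ h‖)
      (Eventually.of_forall fun n => (hqi n).aestronglyMeasurable.norm) ?_ ?_ ?_
    · have : ∀ᶠ n in atTop, |t n| ≤ 1 := by
        have := ht.abs
        rw [abs_zero] at this
        exact this.eventually_le_const one_pos
      filter_upwards [this] with n hn
      refine ae_of_all _ fun h => ?_
      rw [norm_norm]
      refine (norm_add_le _ _).trans ?_
      gcongr
      have := hb (-t n) h (by rwa [abs_neg])
      rwa [inv_neg, neg_mul, norm_neg] at this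
    · exact ((integrable_indicator_iff hK.measurableSet).2
        (integrableOn_const hK.measure_lt_top.ne)).add (hρ.integrable_partialDeriv i).norm
    · refine ae_of_all _ fun h => ?_
      have := hρ.tendsto_diffQuot i (t := fun n => -t n) (by simpa using ht.neg)
        (fun n => neg_ne_zero.2 (ht0 n)) h
      have h2 := (this.neg.add_const (partialDeriv i ρ h)).norm
      simpa [hq, e, inv_neg, neg_mul] using h2
  simpa using hlim

/-- Mollifiers approximating the identity. -/
theorem exists_mollifier_tendsto [CompleteSpace X] (hτ : IsTranslationGroup τ) :
    ∃ (ρ : ℕ → Space d → ℝ) (hρ : ∀ n, IsMollifier (ρ n)),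
      ∀ x, Tendsto (fun n => mollify hτ (hρ n).integrable x) atTop (𝓝 x) := by
  let φ : ℕ → ContDiffBump (0 : Space d) := fun n =>
    { rIn := 1 / ((n : ℝ) + 1) / 2
      rOut := 1 / ((n : ℝ) + 1)
      rIn_pos := by positivity
      rIn_lt_rOut := half_lt_self (by positivity) }
  refine ⟨fun n => (φ n).normed volume,
    fun n => ⟨(φ n).contDiff_normed, (φ n).hasCompactSupport_normed⟩, fun x => ?_⟩
  -- The convolution of the bump with `h ↦ τ (-h) x`, evaluated at 0, is the mollification of `x`.
  have h := ContDiffBump.convolution_tendsto_right_of_continuous (μ := (volume : Measure (Space d)))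
    (φ := φ) (l := atTop) tendsto_one_div_add_atTop_nhds_zero_nat
    ((hτ.continuous_apply x).comp continuous_neg) 0
  simpa [convolution, mollify_apply, hτ.zero] using h

/-- Identities between limits may thus be checked after mollification, where translations are
differentiable. -/
theorem eq_of_forall_mollify_eq [CompleteSpace X] (hτ : IsTranslationGroup τ) {x y : X}
    (h : ∀ (ρ : Space d → ℝ) (hρ : IsMollifier ρ),
      mollify hτ hρ.integrable x = mollify hτ hρ.integrable y) : x = y := by
  obtain ⟨ρ, hρ, hlim⟩ := exists_mollifier_tendsto hτ
  exact tendsto_nhds_unique (hlim x) (by simpa only [h _ (hρ _)] using hlim y)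

end Mollify

/-! ### Compactness for sequences with bounded twisted difference quotients -/

section Compactness

variable {d : ℕ} {X : Type*} [NormedAddCommGroup X] [NormedSpace ℝ X] [CompleteSpace X]
  {τ : Space d → X →L[ℝ] X} {S : Fin d → X →L[ℝ] X}

/-- The translation by `t e_i`. -/
def axisShift (τ : Space d → X →L[ℝ] X) (t : ℝ) (i : Fin d) : X →L[ℝ] X :=
  τ (t • EuclideanSpace.single i 1)

theorem mollify_comm (hτ : IsTranslationGroup τ) (hSτ : ∀ i h, Commute (S i) (τ h))
    {ρ : Space d → ℝ} (hρ : Integrable ρ) (i : Fin d) (x : X) :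
    mollify hτ hρ (S i x) = S i (mollify hτ hρ x) :=
  (map_mollify hτ hτ hρ (S i) (fun h y => DFunLike.congr_fun (hSτ i h).eq y) x).symm

theorem mollify_axisShift (hτ : IsTranslationGroup τ) {ρ : Space d → ℝ} (hρ : Integrable ρ)
    (t : ℝ) (i : Fin d) (x : X) :
    mollify hτ hρ (axisShift τ t i x) = axisShift τ t i (mollify hτ hρ x) :=
  (map_mollify hτ hτ hρ (axisShift τ t i) (fun h y => by
    simp only [axisShift]
    rw [← mul_apply_eq_comp, ← mul_apply_eq_comp, ← hτ.add, ← hτ.add, add_comm]) x).symm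

variable {ε : ℕ → ℝ} {v : ℕ → X} {U : X} {C : ℝ}

/-- The weak limit of `S_i τ_{ε e_i} v - v` is `S_i U - U`. -/
theorem weakLimit_shift_sub (hτ : IsTranslationGroup τ) (hSτ : ∀ i h, Commute (S i) (τ h))
    (hε_pos : ∀ n, 0 < ε n) (hε : Tendsto ε atTop (𝓝 0)) (hv : ∀ n, ‖v n‖ ≤ C)
    (hU : WeakTendsto v U) (i : Fin d) {W : X}
    (hW : WeakTendsto (fun n => S i (axisShift τ (ε n) i (v n)) - v n) W) : W = S i U - U := by
  refine eq_of_forall_mollify_eq hτ fun ρ hρ => ?_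
  set M := mollify hτ hρ.integrable with hM
  -- The difference quotient of `M` converges in norm, so multiplying it by `ε n` gives zero.
  have hD : Tendsto (fun n => S i * ((axisShift τ (ε n) i - 1) * M)) atTop (𝓝 0) := by
    have h1 := hε.smul (tendsto_mollify_diffQuot hτ hρ i hε fun n => (hε_pos n).ne')
    rw [zero_smul] at h1
    have h2 := h1.const_mul (S i)
    rw [mul_zero] at h2
    refine h2.congr fun n => ?_
    rw [smul_inv_smul₀ (hε_pos n).ne', axisShift, hM]
  have h1 := (hU.clm_apply hv hD).add (hU.map ((S i - 1) * M))
  have h2 := hW.map M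
  refine (h2.unique (a := M W) (b := (0 : X →L[ℝ] X) U + ((S i - 1) * M) U) ?_).trans ?_
  · convert h1 using 2 with n
    simp only [mul_apply_eq_comp, sub_apply, one_apply_eq_self, map_sub, hM,
      mollify_comm hτ hSτ, mollify_axisShift]
    abel
  · simp [hM, mollify_comm hτ hSτ]

variable {a : ℕ → ℝ} {α : ℝ} {W : Fin d → X}

/-- The fundamental identity: functionals `ℓ` with `∑ ℓ_i ∘ (S_i - 1) = 0` only see the
slow derivative of the limit. -/
theorem sum_dual_mollify_eq (hτ : IsTranslationGroup τ) (hSτ : ∀ i h, Commute (S i) (τ h))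
    (hε_pos : ∀ n, 0 < ε n) (hε : Tendsto ε atTop (𝓝 0)) (hv : ∀ n, ‖v n‖ ≤ C)
    (hU : WeakTendsto v U) (hUS : U ∈ fixedSpace S) (ha : Tendsto a atTop (𝓝 α))
    (hW : ∀ i, WeakTendsto
      (fun n => a n • (ε n)⁻¹ • (S i (axisShift τ (ε n) i (v n)) - v n)) (W i))
    {ℓ : Fin d → X →L[ℝ] ℝ} (hℓ : ∀ x, ∑ i, ℓ i (S i x - x) = 0) {ρ : Space d → ℝ}
    (hρ : IsMollifier ρ) :
    ∑ i, ℓ i (mollify hτ hρ.integrable (W i)) =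
      -(α * ∑ i, ℓ i (mollify hτ (hρ.integrable_partialDeriv i) U)) := by
  set M := mollify hτ hρ.integrable with hM
  have h1 : Tendsto (fun n => ∑ i, ℓ i (M
      (a n • (ε n)⁻¹ • (S i (axisShift τ (ε n) i (v n)) - v n)))) atTop
      (𝓝 (∑ i, ℓ i (M (W i)))) :=
    tendsto_finsetSum _ fun i _ => (hW i).map M (ℓ i)
  have h2 : Tendsto (fun n => a n * ∑ i, ℓ i (S i
      (((ε n)⁻¹ • ((axisShift τ (ε n) i - 1) * M)) (v n)))) atTop
      (𝓝 (α * ∑ i, ℓ i (S i ((-mollify hτ (hρ.integrable_partialDeriv i)) U)))) := by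
    refine ha.mul (tendsto_finsetSum _ fun i _ => ?_)
    exact (hU.clm_apply hv (tendsto_mollify_diffQuot hτ hρ i hε
      fun n => (hε_pos n).ne')).map (S i) (ℓ i)
  have h3 := tendsto_nhds_unique h1 (h2.congr fun n => ?_)
  · rw [h3, ← mul_neg, ← Finset.sum_neg_distrib]
    congr 1
    -- Since `U` is fixed, so are its mollifications, and the leftover `S i` disappears.
    refine Finset.sum_congr rfl fun i _ => ?_
    rw [neg_apply, map_neg, map_neg, ← mollify_comm hτ hSτ, mem_fixedSpace.1 hUS]
  -- The terms with the singular factor `(ε n)⁻¹` are the coboundaries of the single vector `M (v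
  -- n)`; `ℓ` cancels their sum exactly, for every `n`.
  · have h4 := hℓ (M (v n))
    have h5 : ∀ i, M (S i (axisShift τ (ε n) i (v n)) - v n) =
        S i (((axisShift τ (ε n) i - 1) * M) (v n)) + (S i (M (v n)) - M (v n)) := fun i => by
      simp only [mul_apply_eq_comp, sub_apply, one_apply_eq_self, map_sub, hM,
        mollify_comm hτ hSτ, mollify_axisShift]
      abel
    simp only [map_smul, h5, map_add, smul_apply, smul_eq_mul, Finset.mul_sum, mul_add,
      Finset.sum_add_distrib]
    rw [← Finset.mul_sum, ← Finset.mul_sum, ← Finset.mul_sum, ← Finset.mul_sum, h4]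
    simp

/-- Splitting of the limit of the difference quotients into the gradient of the limit and an
oscillating part. -/
theorem exists_gradient_splitting (hX : HasWeakCompactness X)
    (hcomm : ∀ i j, Commute (S i) (S j)) (hS : ∀ i, ‖S i‖ ≤ 1)
    (hτ : IsTranslationGroup τ) (hSτ : ∀ i h, Commute (S i) (τ h))
    (hε_pos : ∀ n, 0 < ε n) (hε : Tendsto ε atTop (𝓝 0)) (hv : ∀ n, ‖v n‖ ≤ C)
    (hU : WeakTendsto v U) (hUS : U ∈ fixedSpace S)
    (hW : ∀ i, WeakTendsto
      (fun n => (ε n)⁻¹ • (S i (axisShift τ (ε n) i (v n)) - v n)) (W i)) :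
    ∃ G : Fin d → X, (∀ i, G i ∈ fixedSpace S) ∧
      (∀ (ρ : Space d → ℝ) (hρ : IsMollifier ρ) (i : Fin d), mollify hτ hρ.integrable (G i) =
        -mollify hτ (hρ.integrable_partialDeriv i) U) ∧
      ∀ ℓ : Fin d → X →L[ℝ] ℝ, (∀ x, ∑ i, ℓ i (S i x - x) = 0) →
        ∑ i, ℓ i (W i - G i) = 0 := by
  classical
  -- `G i` is the invariant part of `W i`, the candidate for the partial derivative of `U`.
  choose G hG hz using fun i => exists_fixed_add_coboundary hX hcomm hS (W i)
  have key : ∀ ℓ : Fin d → X →L[ℝ] ℝ, (∀ x, ∑ i, ℓ i (S i x - x) = 0) →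
      ∀ (ρ : Space d → ℝ) (hρ : IsMollifier ρ), ∑ i, ℓ i (mollify hτ hρ.integrable (W i)) =
        -∑ i, ℓ i (mollify hτ (hρ.integrable_partialDeriv i) U) := fun ℓ hℓ ρ hρ => by
    have h1 := sum_dual_mollify_eq (a := fun _ => (1 : ℝ)) (α := 1) (W := W) hτ hSτ hε_pos hε
      hv hU hUS tendsto_const_nhds (fun i => by simpa only [one_smul] using hW i) hℓ hρ
    rwa [one_mul] at h1
  have hfix : ∀ {ρ : Space d → ℝ} (hρ : Integrable ρ) {x : X}, x ∈ fixedSpace S →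
      mollify hτ hρ x ∈ fixedSpace S := fun hρ x hx => mem_fixedSpace.2 fun i => by
    rw [← mollify_comm hτ hSτ, mem_fixedSpace.1 hx]
  have hgrad : ∀ (ρ : Space d → ℝ) (hρ : IsMollifier ρ) (i : Fin d),
      mollify hτ hρ.integrable (G i) = -mollify hτ (hρ.integrable_partialDeriv i) U := by
    intro ρ hρ i
    rw [← add_eq_zero_iff_eq_neg]
    -- The difference of the two sides is fixed; it vanishes once every invariant functional kills
    -- it, since it is then also a limit of coboundaries.
    refine eq_zero_of_mem_fixedSpace_of_mem_closure hcomm hS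
      (Submodule.add_mem _ (hfix _ (hG i)) (hfix _ hUS)) (mem_closure_coboundarySpan ?_)
    intro ℓ hℓ
    -- An invariant functional placed in one component is an admissible family.
    have h1 := key (Pi.single i ℓ) (fun x => Finset.sum_eq_zero fun j _ => by
      rcases eq_or_ne j i with rfl | hj
      · simp [hℓ]
      · simp [Pi.single_eq_of_ne hj]) ρ hρ
    rw [Finset.sum_eq_single i (fun j _ hj => by simp [Pi.single_eq_of_ne hj]) (by simp),
      Finset.sum_eq_single i (fun j _ hj => by simp [Pi.single_eq_of_ne hj]) (by simp),
      Pi.single_eq_same] at h1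
    -- Mollification maps coboundaries to coboundaries, so `ℓ` sees only the invariant part of `W
    -- i`.
    have h2 : ℓ (mollify hτ hρ.integrable (W i - G i)) = 0 := by
      have hle : (coboundarySpan S).topologicalClosure ≤
          LinearMap.ker (ℓ.comp (mollify hτ hρ.integrable)).toLinearMap :=
        Submodule.topologicalClosure_minimal _ (coboundarySpan_le fun j x => by
          simp [mollify_comm hτ hSτ, hℓ])
          (ℓ.comp (mollify hτ hρ.integrable)).isClosed_ker
      exact hle (hz i)
    rw [map_sub, map_sub, sub_eq_zero] at h2
    rw [map_add, ← h2, h1, neg_add_cancel]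
  refine ⟨G, hG, hgrad, fun ℓ hℓ => ?_⟩
  obtain ⟨ρ, hρ, hlim⟩ := exists_mollifier_tendsto hτ
  have h1 : Tendsto (fun n => ∑ i, ℓ i (mollify hτ (hρ n).integrable (W i - G i))) atTop
      (𝓝 (∑ i, ℓ i (W i - G i))) :=
    tendsto_finsetSum _ fun i _ => ((ℓ i).continuous.tendsto _).comp (hlim _)
  refine tendsto_nhds_unique h1 (tendsto_const_nhds.congr fun n => ?_)
  simp only [map_sub, hgrad _ (hρ n), Finset.sum_sub_distrib, map_neg, Finset.sum_neg_distrib]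
  rw [key ℓ hℓ _ (hρ n), sub_self]

/-- For vanishing prefactors there is no gradient of the limit. -/
theorem sum_dual_eq_zero (hτ : IsTranslationGroup τ) (hSτ : ∀ i h, Commute (S i) (τ h))
    (hε_pos : ∀ n, 0 < ε n) (hε : Tendsto ε atTop (𝓝 0)) (hv : ∀ n, ‖v n‖ ≤ C)
    (hU : WeakTendsto v U) (hUS : U ∈ fixedSpace S) (ha : Tendsto a atTop (𝓝 0))
    (hW : ∀ i, WeakTendsto
      (fun n => a n • (ε n)⁻¹ • (S i (axisShift τ (ε n) i (v n)) - v n)) (W i))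
    {ℓ : Fin d → X →L[ℝ] ℝ} (hℓ : ∀ x, ∑ i, ℓ i (S i x - x) = 0) : ∑ i, ℓ i (W i) = 0 := by
  obtain ⟨ρ, hρ, hlim⟩ := exists_mollifier_tendsto hτ
  have h1 : Tendsto (fun n => ∑ i, ℓ i (mollify hτ (hρ n).integrable (W i))) atTop
      (𝓝 (∑ i, ℓ i (W i))) :=
    tendsto_finsetSum _ fun i _ => ((ℓ i).continuous.tendsto _).comp (hlim _)
  refine tendsto_nhds_unique h1 (tendsto_const_nhds.congr fun n => ?_)
  rw [sum_dual_mollify_eq hτ hSτ hε_pos hε hv hU hUS ha hW hℓ (hρ n)]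
  simp

end Compactness

/-! ### The dual of `L^p` and weak compactness -/

section Riesz

variable {α : Type*} [MeasurableSpace α] {μ : Measure α} {p q : ℝ≥0∞}

/-- Dominated convergence in `L^p`. -/
theorem tendsto_toLp_of_dominated [Fact (1 ≤ p)] (hp : p ≠ ∞) {ι : Type*} {l : Filter ι}
    [l.IsCountablyGenerated] {f : ι → α → ℝ} {F G : α → ℝ} (hf : ∀ n, MemLp (f n) p μ)
    (hF : MemLp F p μ) (hG : MemLp G p μ) (hb : ∀ n x, |f n x| ≤ G x)
    (hlim : ∀ x, Tendsto (fun n => f n x) l (𝓝 (F x))) :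
    Tendsto (fun n => (hf n).toLp (f n)) l (𝓝 (hF.toLp F)) := by
  have hp0 : p ≠ 0 := (one_pos.trans_le (Fact.out : 1 ≤ p)).ne'
  have hP : 0 < p.toReal := ENNReal.toReal_pos hp0 hp
  rw [Lp.tendsto_Lp_iff_tendsto_eLpNorm'']
  simp only [eLpNorm_eq_lintegral_rpow_enorm_toReal hp0 hp]
  have hGF : MemLp (fun x => |G x| + |F x|) p μ := hG.abs.add hF.abs
  have key : Tendsto (fun n => ∫⁻ x, ‖(f n - F) x‖ₑ ^ p.toReal ∂μ) l (𝓝 (∫⁻ _, 0 ∂μ)) := by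
    refine tendsto_lintegral_filter_of_dominated_convergence' (fun x => ‖|G x| + |F x|‖ₑ ^ p.toReal)
      (Eventually.of_forall fun n =>
        (((hf n).sub hF).aestronglyMeasurable.enorm.pow_const _)) ?_ ?_ ?_
    · refine Eventually.of_forall fun n => ae_of_all _ fun x => ?_
      refine ENNReal.rpow_le_rpow (enorm_le_iff_norm_le.2 ?_) hP.le
      simp only [Pi.sub_apply, Real.norm_eq_abs]
      rw [abs_of_nonneg (a := |G x| + |F x|) (by positivity)]
      exact (abs_sub _ _).trans (add_le_add_left ((hb n x).trans (le_abs_self _)) _)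
    · exact (lintegral_rpow_enorm_lt_top_of_eLpNorm_lt_top hp0 hp hGF.2).ne
    · refine ae_of_all _ fun x => ?_
      have h1 : Tendsto (fun n => ‖(f n - F) x‖ₑ) l (𝓝 0) := by
        have := ((hlim x).sub_const (F x)).enorm
        simpa using this
      have h2 := (ENNReal.continuous_rpow_const (y := p.toReal)).tendsto 0 |>.comp h1
      simpa [ENNReal.zero_rpow_of_pos hP, Function.comp_def] using h2
  rw [lintegral_zero] at key
  have h2 := (ENNReal.continuous_rpow_const (y := 1 / p.toReal)).tendsto 0 |>.comp key
  simpa [ENNReal.zero_rpow_of_pos (inv_pos.2 hP), Function.comp_def] using h2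

/-- The weight stands in for the constant 1, which need not be in `L^p` when the measure is
infinite. It is the `p`-th root of a positive integrable function. -/
theorem exists_pos_memLp [SigmaFinite μ] (hp0 : p ≠ 0) (hp : p ≠ ∞) :
    ∃ w : α → ℝ, Measurable w ∧ (∀ x, 0 < w x) ∧ MemLp w p μ := by
  obtain ⟨g, hg0, hgm, hg⟩ := exists_pos_lintegral_lt_of_sigmaFinite μ one_ne_zero
  have hP : 0 < p.toReal := ENNReal.toReal_pos hp0 hp
  have hm : Measurable fun x => ((g x ^ (p.toReal⁻¹) : NNReal) : ℝ) := by fun_prop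
  refine ⟨_, hm, fun x => NNReal.coe_pos.2 (NNReal.rpow_pos (hg0 x)), hm.aestronglyMeasurable, ?_⟩
  rw [eLpNorm_lt_top_iff_lintegral_rpow_enorm_lt_top hp0 hp]
  refine lt_of_le_of_lt (lintegral_mono fun x => ?_) (hg.trans ENNReal.one_lt_top)
  rw [Real.enorm_eq_ofReal NNReal.zero_le_coe, ENNReal.ofReal_coe_nnreal,
    ← ENNReal.coe_rpow_of_nonneg _ hP.le, NNReal.rpow_inv_rpow hP.ne']

theorem memLp_indicator {w : α → ℝ} (hw : MemLp w p μ) {A : Set α} (hA : MeasurableSet A) :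
    MemLp (A.indicator w) p μ :=
  hw.indicator hA

theorem memLp_mul_bounded {w b : α → ℝ} (hw : MemLp w p μ) (hb : Measurable b) {C : ℝ}
    (hC : ∀ x, |b x| ≤ C) : MemLp (fun x => w x * b x) p μ :=
  MemLp.mul' (p := p) (q := ∞) (memLp_top_of_bound hb.aestronglyMeasurable C (ae_of_all _ hC)) hw

variable [Fact (1 ≤ p)]

/-- Countable additivity of `A ↦ ℓ (w 1_A)`: the finite unions are dominated by `|w|`, so they
converge in `L^p`, where `p ≠ ∞` enters. -/
theorem hasSum_dual_indicator (hp : p ≠ ∞) (ℓ : Lp ℝ p μ →L[ℝ] ℝ) {w : α → ℝ} (hw : MemLp w p μ)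
    {f : ℕ → Set α} (hf : ∀ i, MeasurableSet (f i)) (hd : Pairwise (Function.onFun Disjoint f)) :
    HasSum (fun i => ℓ ((memLp_indicator hw (hf i)).toLp ((f i).indicator w)))
      (ℓ ((memLp_indicator hw (MeasurableSet.iUnion hf)).toLp ((⋃ i, f i).indicator w))) := by
  have hfs : ∀ s : Finset ℕ, MeasurableSet (⋃ i ∈ s, f i) := fun s =>
    s.measurableSet_biUnion fun i _ => hf i
  have h1 := tendsto_toLp_of_dominated hp (l := atTop) (fun s => memLp_indicator hw (hfs s))
    (memLp_indicator hw (MeasurableSet.iUnion hf)) hw.abs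
    (fun s x => by
      by_cases hx : x ∈ ⋃ i ∈ s, f i
      · rw [Set.indicator_of_mem hx, Pi.abs_apply]
      · rw [Set.indicator_of_notMem hx, abs_zero]; exact abs_nonneg _)
    (fun x => (tendsto_indicator_biUnion_finset f w x).mono_right (pure_le_nhds _))
  have h2 := (ℓ.continuous.tendsto _).comp h1
  rw [HasSum, SummationFilter.unconditional_filter]
  refine h2.congr fun s => ?_
  rw [Function.comp_apply]
  rw [← map_sum]
  congr 1
  refine Lp.ext ?_
  have h3 : ∀ᵐ x ∂μ, ∀ i ∈ s, (memLp_indicator hw (hf i)).toLp ((f i).indicator w) x =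
      (f i).indicator w x := by
    refine (ae_ball_iff s.countable_toSet).2 ?_
    exact fun i _ => MemLp.coeFn_toLp (memLp_indicator hw (hf i))
  filter_upwards [MemLp.coeFn_toLp (memLp_indicator hw (hfs s)),
    Lp.coeFn_finsetSum s (fun i => (memLp_indicator hw (hf i)).toLp ((f i).indicator w)),
    h3] with x hx1 hx2 hx3
  rw [hx1, hx2, Finset.sum_apply, Finset.sum_congr rfl hx3,
    Finset.indicator_biUnion_apply s f (fun i _ j _ hij => hd hij)]

open Classical in
/-- The signed measure `A ↦ ℓ (w 1_A)`. -/
def dualSignedMeasure (hp : p ≠ ∞) (ℓ : Lp ℝ p μ →L[ℝ] ℝ) {w : α → ℝ} (hw : MemLp w p μ) :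
    SignedMeasure α where
  measureOf' A := if hA : MeasurableSet A then ℓ ((memLp_indicator hw hA).toLp (A.indicator w)) else 0
  empty' := by
    rw [dif_pos MeasurableSet.empty]
    have h0 : (memLp_indicator hw MeasurableSet.empty).toLp ((∅ : Set α).indicator w) = 0 := by
      rw [Lp.eq_zero_iff_ae_eq_zero]
      filter_upwards [MemLp.coeFn_toLp (memLp_indicator hw MeasurableSet.empty)] with x hx
      rw [hx, Set.indicator_empty]
      rfl
    rw [h0, map_zero]
  not_measurable' A hA := dif_neg hA
  m_iUnion' f hf hd := by
    rw [dif_pos (MeasurableSet.iUnion hf)]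
    refine (hasSum_dual_indicator hp ℓ hw hf hd).congr_fun fun i => ?_
    rw [dif_pos (hf i)]

theorem dualSignedMeasure_apply (hp : p ≠ ∞) (ℓ : Lp ℝ p μ →L[ℝ] ℝ) {w : α → ℝ}
    (hw : MemLp w p μ) {A : Set α} (hA : MeasurableSet A) :
    dualSignedMeasure hp ℓ hw A = ℓ ((memLp_indicator hw hA).toLp (A.indicator w)) :=
  dif_pos hA

/-- A density for the functional `b ↦ ℓ (w b)`, `b` bounded. -/
theorem exists_dual_density [SigmaFinite μ] (hp : p ≠ ∞) (ℓ : Lp ℝ p μ →L[ℝ] ℝ) {w : α → ℝ}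
    (hw : MemLp w p μ) :
    ∃ g : α → ℝ, Measurable g ∧ Integrable g μ ∧ ∀ (b : α → ℝ), Measurable b → ∀ C : ℝ,
      (∀ x, |b x| ≤ C) → ∀ h : MemLp (fun x => w x * b x) p μ,
        ℓ (h.toLp _) = ∫ x, b x * g x ∂μ := by
  set s := dualSignedMeasure hp ℓ hw with hs
  have hac : s ≪ᵥ μ.toENNRealVectorMeasure := by
    refine VectorMeasure.AbsolutelyContinuous.mk fun A hA hA0 => ?_
    rw [Measure.toENNRealVectorMeasure_apply_measurable hA] at hA0
    rw [hs, dualSignedMeasure_apply hp ℓ hw hA]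
    have h0 : (memLp_indicator hw hA).toLp (A.indicator w) = 0 := by
      rw [Lp.eq_zero_iff_ae_eq_zero]
      filter_upwards [MemLp.coeFn_toLp (memLp_indicator hw hA), measure_eq_zero_iff_ae_notMem.1 hA0]
        with x hx hxA
      rw [hx, Set.indicator_of_notMem hxA, Pi.zero_apply]
    rw [h0, map_zero]
  have hgm := SignedMeasure.measurable_rnDeriv s μ
  have hgi := SignedMeasure.integrable_rnDeriv s μ
  have hset : ∀ A (hA : MeasurableSet A), ℓ ((memLp_indicator hw hA).toLp (A.indicator w)) =
      ∫ x in A, s.rnDeriv μ x ∂μ := fun A hA => by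
    rw [← dualSignedMeasure_apply hp ℓ hw hA, ← withDensityᵥ_apply hgi hA,
      SignedMeasure.withDensityᵥ_rnDeriv_eq s μ hac]
  refine ⟨s.rnDeriv μ, hgm, hgi, ?_⟩
  set g := s.rnDeriv μ
  have hbg : ∀ {b : α → ℝ}, Measurable b → ∀ C : ℝ, (∀ x, |b x| ≤ C) →
      Integrable (fun x => b x * g x) μ := fun hb C hC =>
    hgi.bdd_mul hb.aestronglyMeasurable (ae_of_all _ hC)
  have hsimple : ∀ φ : SimpleFunc α ℝ, ∀ h : MemLp (fun x => w x * φ x) p μ,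
      ℓ (h.toLp _) = ∫ x, φ x * g x ∂μ := by
    intro φ
    induction φ using SimpleFunc.induction with
    | const c hA =>
      rename_i A
      intro h
      have h1 : h.toLp _ = c • (memLp_indicator hw hA).toLp (A.indicator w) := by
        rw [← MemLp.toLp_const_smul]
        refine MemLp.toLp_congr _ _ (ae_of_all _ fun x => ?_)
        by_cases hx : x ∈ A <;> simp [hx, mul_comm]
      rw [h1, map_smul, hset A hA, smul_eq_mul, ← integral_const_mul, ← integral_indicator hA]
      refine integral_congr_ae (ae_of_all _ fun x => ?_)
      by_cases hx : x ∈ A <;> simp [hx]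
    | add _ hφ hψ =>
      rename_i φ ψ _
      intro h
      obtain ⟨C, hC⟩ := φ.exists_forall_norm_le
      obtain ⟨D, hD⟩ := ψ.exists_forall_norm_le
      have h1 := memLp_mul_bounded hw φ.measurable hC
      have h2 := memLp_mul_bounded hw ψ.measurable hD
      have h3 : h.toLp _ = h1.toLp _ + h2.toLp _ := by
        rw [← MemLp.toLp_add]
        exact MemLp.toLp_congr _ _ (ae_of_all _ fun x => by simp [mul_add])
      rw [h3, map_add, hφ h1, hψ h2,
        ← integral_add (hbg φ.measurable C hC) (hbg ψ.measurable D hD)]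
      simp [add_mul]
  intro b hb C hC h
  set φ : ℕ → SimpleFunc α ℝ := SimpleFunc.approxOn b hb Set.univ 0 (Set.mem_univ 0) with hφ
  -- The approximations starting from 0 are bounded by twice the norm of `b`.
  have hφb : ∀ n x, |φ n x| ≤ C + C := fun n x =>
    (SimpleFunc.norm_approxOn_zero_le hb (Set.mem_univ 0) x n).trans (add_le_add (hC x) (hC x))
  have hφl : ∀ x, Tendsto (fun n => φ n x) atTop (𝓝 (b x)) := fun x =>
    SimpleFunc.tendsto_approxOn hb (Set.mem_univ 0) (by simp)
  have hm := fun n => memLp_mul_bounded hw (φ n).measurable (hφb n)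
  have h1 := (ℓ.continuous.tendsto _).comp (tendsto_toLp_of_dominated hp (l := atTop) hm h
    (hw.abs.const_mul (C + C)) (fun n x => by
      rw [abs_mul, mul_comm]
      exact mul_le_mul_of_nonneg_right (hφb n x) (abs_nonneg _)) fun x => (hφl x).const_mul _)
  have h2 : Tendsto (fun n => ∫ x, φ n x * g x ∂μ) atTop (𝓝 (∫ x, b x * g x ∂μ)) := by
    refine tendsto_integral_of_dominated_convergence (fun x => (C + C) * |g x|)
      (fun n => (hbg (φ n).measurable _ (hφb n)).aestronglyMeasurable) (hgi.abs.const_mul _)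
      (fun n => ae_of_all _ fun x => ?_) (ae_of_all _ fun x => (hφl x).mul_const _)
    rw [Real.norm_eq_abs, abs_mul]
    exact mul_le_mul_of_nonneg_right (hφb n x) (abs_nonneg _)
  refine tendsto_nhds_unique h1 (h2.congr fun n => ?_)
  exact (hsimple (φ n) (hm n)).symm

theorem norm_toLp_rpow (hp : p ≠ ∞) {f : α → ℝ} (hf : MemLp f p μ) :
    ‖hf.toLp f‖ = (∫ x, |f x| ^ p.toReal ∂μ) ^ (p.toReal⁻¹) := by
  have hp0 : p ≠ 0 := (one_pos.trans_le (Fact.out : 1 ≤ p)).ne'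
  rw [Lp.norm_toLp, hf.eLpNorm_eq_integral_rpow_norm hp0 hp, ENNReal.toReal_ofReal]
  · rfl
  · exact Real.rpow_nonneg (integral_nonneg fun x => Real.rpow_nonneg (norm_nonneg _) _) _

/-- The dual of `L^p` is `L^q`. -/
theorem exists_eq_integral_mul [SigmaFinite μ] (hp : p ≠ ∞)
    (hpq : p.toReal.HolderConjugate q.toReal) (ℓ : Lp ℝ p μ →L[ℝ] ℝ) :
    ∃ g : α → ℝ, MemLp g q μ ∧ ∀ f : Lp ℝ p μ, ℓ f = ∫ x, f x * g x ∂μ := by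
  have hp0 : p ≠ 0 := (one_pos.trans_le (Fact.out : 1 ≤ p)).ne'
  have hq : q ≠ ∞ := fun h => by simpa [h] using hpq.symm.pos
  have hq0 : q ≠ 0 := fun h => by simpa [h] using hpq.symm.pos
  have hpq' : p.HolderConjugate q := ENNReal.HolderConjugate.of_toReal hpq
  set P := p.toReal with hP
  set Q := q.toReal with hQ
  obtain ⟨w, hwm, hw0, hw⟩ := exists_pos_memLp (μ := μ) hp0 hp
  obtain ⟨g₀, hg₀m, hg₀i, hg₀⟩ := exists_dual_density hp ℓ hw
  -- Dividing out the weight turns the density of `b ↦ ℓ (w b)` into one for `ℓ`, so far only on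
  -- functions dominated by a multiple of `w`.
  set g : α → ℝ := fun x => g₀ x / w x with hg
  have hgm : Measurable g := hg₀m.div hwm
  have hwg : ∀ x, g₀ x = w x * g x := fun x => by
    simp only [hg]; field_simp [(hw0 x).ne']
  have hdom : ∀ (f : α → ℝ), Measurable f → ∀ C : ℝ, (∀ x, |f x| ≤ C * w x) →
      ∀ h : MemLp f p μ, Integrable (fun x => f x * g x) μ ∧ ℓ (h.toLp f) = ∫ x, f x * g x ∂μ := by
    intro f hf C hC h
    have hb : ∀ x, |f x / w x| ≤ C := fun x => by
      rw [abs_div, abs_of_pos (hw0 x), div_le_iff₀ (hw0 x)]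
      exact hC x
    have h1 : (fun x => w x * (f x / w x)) = f := funext fun x => mul_div_cancel₀ _ (hw0 x).ne'
    have h2 : (fun x => f x / w x * g₀ x) = fun x => f x * g x := funext fun x => by
      rw [hwg, ← mul_assoc, div_mul_cancel₀ _ (hw0 x).ne']
    refine ⟨?_, ?_⟩
    · rw [← h2]
      exact hg₀i.bdd_mul (hf.div hwm).aestronglyMeasurable (ae_of_all _ hb)
    · have h3 := hg₀ (fun x => f x / w x) (hf.div hwm) C hb (by rw [h1]; exact h)
      rw [h2] at h3
      rw [← h3]
      congr 1
      exact MemLp.toLp_congr _ _ (by rw [h1])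
  set A : ℕ → Set α := fun k => {x | |g x| ^ (Q - 1) ≤ k * w x} with hA
  have hAm : ∀ k, MeasurableSet (A k) := fun k =>
    measurableSet_le (hgm.abs.pow_const _) (hwm.const_mul _)
  have hAU : ⋃ k, A k = Set.univ := Set.eq_univ_of_forall fun x => by
    obtain ⟨k, hk⟩ := exists_nat_ge (|g x| ^ (Q - 1) / w x)
    exact Set.mem_iUnion.2 ⟨k, (div_le_iff₀ (hw0 x)).1 hk⟩
  have hAd : Monotone A := fun k m hkm x hx => le_trans (b := k * w x) hx (by
    have := (hw0 x).le
    gcongr)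
  have hbound : ∀ k, ∫⁻ x in A k, ‖g x‖ₑ ^ Q ∂μ ≤ ENNReal.ofReal (‖ℓ‖ ^ Q) := by
    intro k
    -- The extremal function of Hölder's inequality, with `f g = |f|^P = |g|^Q` on `A k`. The
    -- truncation keeps it below `k w`, hence admissible.
    set f : α → ℝ := (A k).indicator fun x => SignType.sign (g x) * |g x| ^ (Q - 1) with hf
    have hsm : Measurable fun x => ((SignType.sign (g x) : SignType) : ℝ) := by
      have : Measurable fun y : ℝ => ((SignType.sign y : SignType) : ℝ) := by
        have : (fun y : ℝ => ((SignType.sign y : SignType) : ℝ)) =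
            fun y => if 0 < y then 1 else if y < 0 then -1 else 0 := by
          ext y
          rcases lt_trichotomy y 0 with h | h | h
          · simp [h, h.not_gt]
          · simp [h]
          · simp [h]
        rw [this]
        exact Measurable.ite measurableSet_Ioi measurable_const
          (Measurable.ite measurableSet_Iio measurable_const measurable_const)
      exact this.comp hgm
    have hfm : Measurable f := (hsm.mul (hgm.abs.pow_const _)).indicator (hAm k)
    have hQ1 := hpq.symm.sub_one_pos
    have hfabs : ∀ x, |f x| = (A k).indicator (fun x => |g x| ^ (Q - 1)) x := by
      intro x
      by_cases hx : x ∈ A k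
      · simp only [hf, Set.indicator_of_mem hx, abs_mul]
        rcases eq_or_ne (g x) 0 with h0 | h0
        · simp [h0, Real.zero_rpow hQ1.ne']
        · rw [abs_of_nonneg (Real.rpow_nonneg (abs_nonneg _) _)]
          rcases lt_or_gt_of_ne h0 with h | h <;> simp [h]
      · simp [hf, hx]
    have hfw : ∀ x, |f x| ≤ k * w x := by
      intro x
      rw [hfabs]
      have := (hw0 x).le
      exact Set.indicator_apply_le' (fun hx => hx) fun _ => by positivity
    have hfL : MemLp f p μ := (hw.const_mul (k : ℝ)).mono hfm.aestronglyMeasurable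
      (ae_of_all _ fun x => (hfw x).trans (le_abs_self _))
    obtain ⟨hint, hval⟩ := hdom f hfm k hfw hfL
    have hfg : (fun x => f x * g x) = (A k).indicator fun x => |g x| ^ Q := by
      ext x
      by_cases hx : x ∈ A k
      · simp only [hf, Set.indicator_of_mem hx]
        rw [mul_right_comm, sign_mul_self]
        rcases eq_or_ne (g x) 0 with h0 | h0
        · simp [h0, Real.zero_rpow hpq.symm.pos.ne']
        · rw [← Real.rpow_one_add' (abs_nonneg _) (by rw [add_sub_cancel]; exact hpq.symm.pos.ne'),
            add_sub_cancel]
      · simp [hf, hx]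
    have hfp : (fun x => |f x| ^ P) = (A k).indicator fun x => |g x| ^ Q := by
      ext x
      rw [hfabs]
      by_cases hx : x ∈ A k
      · simp only [Set.indicator_of_mem hx]
        rw [← Real.rpow_mul (abs_nonneg _), hpq.symm.sub_one_mul_conj]
      · simp [hx, Real.zero_rpow hpq.pos.ne']
    rw [hfg] at hint hval
    set I := ∫ x, (A k).indicator (fun x => |g x| ^ Q) x ∂μ with hI
    have hI0 : 0 ≤ I := integral_nonneg fun x => Set.indicator_nonneg
      (fun _ _ => Real.rpow_nonneg (abs_nonneg _) _) x
    have hle : I ≤ ‖ℓ‖ * I ^ P⁻¹ := by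
      have h1 := (le_abs_self _).trans (ℓ.le_opNorm (hfL.toLp f))
      rw [hval, norm_toLp_rpow hp, ← hP, hfp] at h1
      exact h1
    -- Dividing `I ≤ ‖ℓ‖ I^{1/P}` by `I^{1/P}` leaves a bound independent of `k`, so `k → ∞` is
    -- allowed.
    have hIQ : I ≤ ‖ℓ‖ ^ Q := by
      rcases hI0.eq_or_lt with h0 | h0
      · rw [← h0]; positivity
      · have h1 : I ^ Q⁻¹ ≤ ‖ℓ‖ := by
          have h2 : I = I ^ Q⁻¹ * I ^ P⁻¹ := by
            rw [← Real.rpow_add h0, hpq.symm.inv_add_inv_eq_one, Real.rpow_one]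
          have h3 : 0 < I ^ P⁻¹ := Real.rpow_pos_of_pos h0 _
          refine le_of_mul_le_mul_right ?_ h3
          rw [← h2]; exact hle
        calc I = (I ^ Q⁻¹) ^ Q := (Real.rpow_inv_rpow hI0 hpq.symm.pos.ne').symm
          _ ≤ _ := Real.rpow_le_rpow (Real.rpow_nonneg hI0 _) h1 hpq.symm.nonneg
    calc ∫⁻ x in A k, ‖g x‖ₑ ^ Q ∂μ
        = ∫⁻ x, ENNReal.ofReal ((A k).indicator (fun x => |g x| ^ Q) x) ∂μ := by
          rw [← lintegral_indicator (hAm k)]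
          refine lintegral_congr fun x => ?_
          by_cases hx : x ∈ A k
          · simp only [Set.indicator_of_mem hx]
            rw [← ENNReal.ofReal_rpow_of_nonneg (abs_nonneg _) hpq.symm.nonneg,
              Real.enorm_eq_ofReal_abs]
          · simp [hx]
      _ = ENNReal.ofReal I := (ofReal_integral_eq_lintegral_ofReal hint (ae_of_all _ fun x =>
          Set.indicator_nonneg (fun _ _ => Real.rpow_nonneg (abs_nonneg _) _) x)).symm
      _ ≤ _ := ENNReal.ofReal_le_ofReal hIQ
  have hgL : MemLp g q μ := by
    refine ⟨hgm.aestronglyMeasurable, ?_⟩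
    rw [eLpNorm_lt_top_iff_lintegral_rpow_enorm_lt_top hq0 hq, ← setLIntegral_univ, ← hAU,
      setLIntegral_iUnion_of_directed _ hAd.directed_le]
    exact (iSup_le hbound).trans_lt ENNReal.ofReal_lt_top
  refine ⟨g, hgL, fun F => ?_⟩
  obtain ⟨f, hfm, hf⟩ := (Lp.aestronglyMeasurable F).aemeasurable
  have hfL : MemLp f p μ := (Lp.memLp F).ae_eq hf
  have hF : F = hfL.toLp f := by
    rw [← Lp.toLp_coeFn F (Lp.memLp F)]
    exact MemLp.toLp_congr _ _ hf
  set B : ℕ → Set α := fun k => {x | |f x| ≤ k * w x} with hB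
  have hBm : ∀ k, MeasurableSet (B k) := fun k =>
    measurableSet_le hfm.abs (hwm.const_mul _)
  have hfk := fun k => memLp_indicator hfL (hBm k)
  have hle : ∀ k x, |(B k).indicator f x| ≤ |f x| := fun k x => by
    by_cases hx : x ∈ B k <;> simp [hx]
  have hlim : ∀ x, Tendsto (fun k => (B k).indicator f x) atTop (𝓝 (f x)) := fun x => by
    obtain ⟨k, hk⟩ := exists_nat_ge (|f x| / w x)
    refine tendsto_const_nhds.congr' ?_
    filter_upwards [eventually_ge_atTop k] with m hm
    rw [Set.indicator_of_mem]
    refine ((div_le_iff₀ (hw0 x)).1 hk).trans ?_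
    have := (hw0 x).le
    gcongr
  have h1 := (ℓ.continuous.tendsto _).comp (tendsto_toLp_of_dominated hp hfk hfL hfL.abs hle hlim)
  have hfgi : Integrable (fun x => f x * g x) μ := hfL.integrable_mul hgL
  have h2 : Tendsto (fun k => ∫ x, (B k).indicator f x * g x ∂μ) atTop
      (𝓝 (∫ x, f x * g x ∂μ)) := by
    refine tendsto_integral_of_dominated_convergence (fun x => |f x * g x|)
      (fun k => ((hfm.indicator (hBm k)).mul hgm).aestronglyMeasurable) hfgi.abs
      (fun k => ae_of_all _ fun x => ?_) (ae_of_all _ fun x => (hlim x).mul_const _)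
    rw [Real.norm_eq_abs, abs_mul, abs_mul]
    exact mul_le_mul_of_nonneg_right (hle k x) (abs_nonneg _)
  have h3 : ℓ F = ∫ x, f x * g x ∂μ := by
    rw [hF]
    refine tendsto_nhds_unique h1 (h2.congr fun k => ?_)
    refine (hdom _ (hfm.indicator (hBm k)) k (fun x => ?_) (hfk k)).2.symm
    by_cases hx : x ∈ B k
    · rw [Set.indicator_of_mem hx]; exact hx
    · have := (hw0 x).le
      rw [Set.indicator_of_notMem hx, abs_zero]; positivity
  rw [h3]
  refine integral_congr_ae ?_
  filter_upwards [hf] with x hx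
  rw [hx]

/-- Weak sequential compactness in `L^p`. -/
theorem hasWeakCompactness_Lp [SigmaFinite μ] [Fact (1 ≤ q)] (hp : p ≠ ∞)
    (hpq : p.toReal.HolderConjugate q.toReal)
    [TopologicalSpace.SeparableSpace (Lp ℝ q μ)] : HasWeakCompactness (Lp ℝ p μ) := by
  have hq : q ≠ ∞ := fun h => by simpa [h] using hpq.symm.pos
  have hpq' : p.HolderConjugate q := ENNReal.HolderConjugate.of_toReal hpq
  intro C x hx
  -- `L^p` is viewed inside the dual of `L^q`. The weak-* limit is represented in `L^p`, and every
  -- functional on `L^p` is evaluation at some element of `L^q`, so weak-* convergence is weak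
  -- convergence.
  set Φ : Lp ℝ p μ →L[ℝ] Lp ℝ q μ →L[ℝ] ℝ :=
    (ContinuousLinearMap.mul ℝ ℝ).lpPairing μ p q with hΦ
  have hΦa : ∀ f g, Φ f g = ∫ a, f a * g a ∂μ := fun f g =>
    ContinuousLinearMap.lpPairing_eq_integral _ f g
  obtain ⟨Λ, -, k, hk, hΛ⟩ := WeakDual.isSeqCompact_closedBall ℝ (Lp ℝ q μ) 0 (‖Φ‖ * C)
    (x := fun n => StrongDual.toWeakDual (Φ (x n))) fun n => by
      simp only [Set.mem_preimage, mem_closedBall_zero_iff]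
      exact (Φ.le_opNorm _).trans (by gcongr; exact hx n)
  obtain ⟨a, ha, hΛa⟩ := exists_eq_integral_mul hq hpq.symm (WeakDual.toStrongDual Λ)
  refine ⟨ha.toLp a, k, hk, fun ℓ => ?_⟩
  obtain ⟨g, hg, hℓ⟩ := exists_eq_integral_mul hp hpq ℓ
  have h1 : ∀ f : Lp ℝ p μ, ℓ f = Φ f (hg.toLp g) := fun f => by
    rw [hℓ, hΦa]
    refine integral_congr_ae ?_
    filter_upwards [hg.coeFn_toLp] with y hy
    rw [hy]
  have h2 : ℓ (ha.toLp a) = Λ (hg.toLp g) := by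
    refine (hℓ _).trans (Eq.trans ?_ (hΛa (hg.toLp g)).symm)
    refine integral_congr_ae ?_
    filter_upwards [hg.coeFn_toLp, ha.coeFn_toLp] with y hy hy'
    rw [hy, hy', mul_comm]
  rw [h2]
  have h3 := ((WeakDual.eval_continuous (𝕜 := ℝ) (hg.toLp g)).tendsto Λ).comp hΛ
  refine h3.congr fun n => ?_
  exact (h1 _).symm

end Riesz

/-! ### Tensor products of `L^p` functions -/

section TensorProduct

variable {α β : Type*} [MeasurableSpace α] [MeasurableSpace β] {μ : Measure α} {ν : Measure β}
  [SigmaFinite μ] [SigmaFinite ν] {p q : ℝ≥0∞}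

omit [SigmaFinite μ] in
theorem eLpNorm_tensor (hp0 : p ≠ 0) (hp : p ≠ ∞) {f : α → ℝ} {g : β → ℝ} (hf : MemLp f p μ)
    (hg : MemLp g p ν) :
    eLpNorm (fun z : α × β => f z.1 * g z.2) p (μ.prod ν) = eLpNorm f p μ * eLpNorm g p ν := by
  have hP : 0 < p.toReal := ENNReal.toReal_pos hp0 hp
  simp only [eLpNorm_eq_lintegral_rpow_enorm_toReal hp0 hp, enorm_mul,
    ENNReal.mul_rpow_of_nonneg _ _ hP.le]
  rw [lintegral_prod_mul (hf.aestronglyMeasurable.enorm.pow_const _)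
    (hg.aestronglyMeasurable.enorm.pow_const _), ENNReal.mul_rpow_of_nonneg _ _ (by positivity)]

omit [SigmaFinite μ] in
theorem memLp_tensor (hp0 : p ≠ 0) (hp : p ≠ ∞) {f : α → ℝ} {g : β → ℝ} (hf : MemLp f p μ)
    (hg : MemLp g p ν) : MemLp (fun z : α × β => f z.1 * g z.2) p (μ.prod ν) :=
  ⟨hf.aestronglyMeasurable.comp_fst.mul hg.aestronglyMeasurable.comp_snd, by
    rw [eLpNorm_tensor hp0 hp hf hg]
    exact ENNReal.mul_lt_top hf.2 hg.2⟩

variable [Fact (1 ≤ p)]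

theorem ne_zero_of_fact : p ≠ 0 := (one_pos.trans_le (Fact.out : 1 ≤ p)).ne'

omit [SigmaFinite μ] [SigmaFinite ν] in
theorem ae_fst {r : α → Prop} (h : ∀ᵐ x ∂μ, r x) : ∀ᵐ z ∂μ.prod ν, r z.1 :=
  Measure.quasiMeasurePreserving_fst.ae h

omit [SigmaFinite μ] [SigmaFinite ν] in
theorem ae_snd {r : β → Prop} (h : ∀ᵐ x ∂ν, r x) : ∀ᵐ z ∂μ.prod ν, r z.2 :=
  Measure.quasiMeasurePreserving_snd.ae h

variable (μ ν p) in
/-- The tensor product `(φ, η) ↦ φ ⊗ η` as a continuous bilinear map. -/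
def tensor (hp : p ≠ ∞) : Lp ℝ p μ →L[ℝ] Lp ℝ p ν →L[ℝ] Lp ℝ p (μ.prod ν) :=
  LinearMap.mkContinuous₂
    (LinearMap.mk₂ ℝ
      (fun φ η => (memLp_tensor ne_zero_of_fact hp (Lp.memLp φ) (Lp.memLp η)).toLp _)
      (fun φ φ' η => by
        rw [← MemLp.toLp_add]
        refine MemLp.toLp_congr _ _ ?_
        filter_upwards [ae_fst (ν := ν) (Lp.coeFn_add φ φ')] with z hz
        rw [hz, Pi.add_apply, Pi.add_apply, add_mul])
      (fun c φ η => by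
        rw [← MemLp.toLp_const_smul]
        refine MemLp.toLp_congr _ _ ?_
        filter_upwards [ae_fst (ν := ν) (Lp.coeFn_smul c φ)] with z hz
        rw [hz, Pi.smul_apply, Pi.smul_apply, smul_mul_assoc])
      (fun φ η η' => by
        rw [← MemLp.toLp_add]
        refine MemLp.toLp_congr _ _ ?_
        filter_upwards [ae_snd (μ := μ) (Lp.coeFn_add η η')] with z hz
        rw [hz, Pi.add_apply, Pi.add_apply, mul_add])
      (fun c φ η => by
        rw [← MemLp.toLp_const_smul]
        refine MemLp.toLp_congr _ _ ?_
        filter_upwards [ae_snd (μ := μ) (Lp.coeFn_smul c η)] with z hz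
        rw [hz, Pi.smul_apply, Pi.smul_apply, mul_smul_comm]))
    1 fun φ η => by
      simp only [LinearMap.mk₂_apply]
      rw [Lp.norm_toLp, eLpNorm_tensor ne_zero_of_fact hp (Lp.memLp φ) (Lp.memLp η),
        ENNReal.toReal_mul, one_mul]
      rfl

omit [SigmaFinite μ] in
theorem coeFn_tensor (hp : p ≠ ∞) (φ : Lp ℝ p μ) (η : Lp ℝ p ν) :
    tensor μ ν p hp φ η =ᵐ[μ.prod ν] fun z => φ z.1 * η z.2 :=
  MemLp.coeFn_toLp (memLp_tensor ne_zero_of_fact hp (Lp.memLp φ) (Lp.memLp η))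

omit [SigmaFinite μ] in
theorem tensor_toLp (hp : p ≠ ∞) {f : α → ℝ} {g : β → ℝ} (hf : MemLp f p μ) (hg : MemLp g p ν) :
    tensor μ ν p hp (hf.toLp f) (hg.toLp g) =
      (memLp_tensor ne_zero_of_fact hp hf hg).toLp _ := by
  refine Lp.ext ?_
  filter_upwards [coeFn_tensor hp (hf.toLp f) (hg.toLp g), ae_fst (ν := ν) hf.coeFn_toLp,
    ae_snd (μ := μ) hg.coeFn_toLp,
    (memLp_tensor ne_zero_of_fact hp hf hg).coeFn_toLp] with z h1 h2 h3 h4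
  rw [h1, h2, h3, h4]

omit [SigmaFinite μ] [SigmaFinite ν] in
/-- An integrable function on a product is determined by its integrals over rectangles. -/
theorem ae_eq_zero_of_integral_rectangle {h : α × β → ℝ} (hi : Integrable h (μ.prod ν))
    (h0 : ∀ A B, MeasurableSet A → MeasurableSet B → ∫ z in A ×ˢ B, h z ∂(μ.prod ν) = 0) :
    h =ᵐ[μ.prod ν] 0 := by
  have hall : ∀ s, MeasurableSet s → ∫ z in s, h z ∂(μ.prod ν) = 0 := by
    refine MeasurableSpace.induction_on_inter generateFrom_prod.symm isPiSystem_prod ?_ ?_ ?_ ?_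
    · simp
    · rintro _ ⟨A, hA, B, hB, rfl⟩
      exact h0 A B hA hB
    · intro t ht ih
      have h1 := integral_add_compl ht hi
      have h2 := h0 Set.univ Set.univ MeasurableSet.univ MeasurableSet.univ
      rw [Set.univ_prod_univ, setIntegral_univ] at h2
      rw [ih, h2, zero_add] at h1
      exact h1
    · intro f hd hf ih
      have h1 := hasSum_integral_iUnion hf hd hi.integrableOn
      simp only [ih] at h1
      exact h1.unique hasSum_zero
  exact hi.ae_eq_zero_of_forall_setIntegral_eq_zero fun s hs _ => hall s hs

/-- A functional vanishing on tensors vanishes. -/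
theorem dual_eq_zero_of_tensor (hp : p ≠ ∞) (hpq : p.toReal.HolderConjugate q.toReal)
    {ℓ : Lp ℝ p (μ.prod ν) →L[ℝ] ℝ} (h : ∀ φ η, ℓ (tensor μ ν p hp φ η) = 0) : ℓ = 0 := by
  obtain ⟨g, hg, hℓ⟩ := exists_eq_integral_mul hp hpq ℓ
  have hpq' : p.HolderConjugate q := ENNReal.HolderConjugate.of_toReal hpq
  obtain ⟨w₁, hw₁m, hw₁0, hw₁⟩ := exists_pos_memLp (μ := μ) (p := p) ne_zero_of_fact hp
  obtain ⟨w₂, hw₂m, hw₂0, hw₂⟩ := exists_pos_memLp (μ := ν) (p := p) ne_zero_of_fact hp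
  have hw := memLp_tensor (μ := μ) (ν := ν) ne_zero_of_fact hp hw₁ hw₂
  -- The density `g` need not be integrable; multiplied by a positive tensor it is, and nothing is
  -- lost.
  have hzero : (fun z : α × β => w₁ z.1 * w₂ z.2 * g z) =ᵐ[μ.prod ν] 0 := by
    refine ae_eq_zero_of_integral_rectangle (hw.integrable_mul hg) fun A B hA hB => ?_
    have h1 := h ((memLp_indicator hw₁ hA).toLp _) ((memLp_indicator hw₂ hB).toLp _)
    rw [tensor_toLp, hℓ] at h1
    rw [← integral_indicator (hA.prod hB), ← h1]
    refine integral_congr_ae ?_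
    filter_upwards [(memLp_tensor ne_zero_of_fact hp (memLp_indicator hw₁ hA)
      (memLp_indicator hw₂ hB)).coeFn_toLp] with z hz
    rw [hz]
    by_cases hA' : z.1 ∈ A <;> by_cases hB' : z.2 ∈ B <;> simp [Set.indicator, hA', hB']
  ext f
  rw [hℓ, zero_apply]
  refine (integral_congr_ae ?_).trans (integral_zero _ _)
  filter_upwards [hzero] with z hz
  have : g z = 0 := by
    simpa [(hw₁0 z.1).ne', (hw₂0 z.2).ne'] using hz
  rw [this, mul_zero]

/-- Tensors span a dense subspace. -/
theorem topologicalClosure_span_tensor (hp : p ≠ ∞) (hpq : p.toReal.HolderConjugate q.toReal) :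
    (Submodule.span ℝ (Set.range fun x : Lp ℝ p μ × Lp ℝ p ν =>
      tensor μ ν p hp x.1 x.2)).topologicalClosure = ⊤ := by
  refine eq_top_iff.2 fun f _ => mem_of_forall_dual_eq_zero
    (Submodule.isClosed_topologicalClosure _) fun ℓ hℓ => ?_
  rw [dual_eq_zero_of_tensor hp hpq fun φ η => hℓ _ (Submodule.le_topologicalClosure _
    (Submodule.subset_span ⟨(φ, η), rfl⟩)), zero_apply]

/-- The tensors are a continuous image of a separable space, and their span is dense. -/
theorem separableSpace_Lp_prod (hp : p ≠ ∞) (hpq : p.toReal.HolderConjugate q.toReal)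
    [TopologicalSpace.SeparableSpace (Lp ℝ p μ)] [TopologicalSpace.SeparableSpace (Lp ℝ p ν)] :
    TopologicalSpace.SeparableSpace (Lp ℝ p (μ.prod ν)) := by
  rw [← TopologicalSpace.isSeparable_univ_iff, ← Submodule.top_coe (R := ℝ),
    ← topologicalClosure_span_tensor (μ := μ) (ν := ν) hp hpq, Submodule.topologicalClosure_coe]
  refine (TopologicalSpace.IsSeparable.span (R := ℝ)
    (TopologicalSpace.isSeparable_range ?_)).closure
  exact ((tensor μ ν p hp).continuous.comp continuous_fst).clm_apply continuous_snd

end TensorProduct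

/-! ### Composition operators -/

section Composition

variable {α : Type*} [MeasurableSpace α] {μ : Measure α} {p : ℝ≥0∞} [Fact (1 ≤ p)]

variable (p) in
/-- Composition with a measure preserving map as a bounded operator. -/
def compL (f : α → α) (hf : MeasurePreserving f μ μ) : Lp ℝ p μ →L[ℝ] Lp ℝ p μ :=
  (Lp.compMeasurePreservingₗᵢ ℝ f hf).toContinuousLinearMap

variable {f g : α → α}

theorem coeFn_compL (hf : MeasurePreserving f μ μ) (φ : Lp ℝ p μ) :
    compL p f hf φ =ᵐ[μ] φ ∘ f :=
  Lp.coeFn_compMeasurePreserving φ hf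

theorem norm_compL_apply (hf : MeasurePreserving f μ μ) (φ : Lp ℝ p μ) :
    ‖compL p f hf φ‖ = ‖φ‖ :=
  Lp.norm_compMeasurePreserving φ hf

theorem norm_compL_le (hf : MeasurePreserving f μ μ) : ‖compL p f hf‖ ≤ 1 :=
  ContinuousLinearMap.opNorm_le_bound _ zero_le_one fun φ => by
    rw [norm_compL_apply, one_mul]

/-- Composition is contravariant, so the maps appear in reverse order. -/
theorem compL_mul (hf : MeasurePreserving f μ μ) (hg : MeasurePreserving g μ μ) :
    compL p f hf * compL p g hg = compL p (g ∘ f) (hg.comp hf) := by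
  ext1 φ
  exact (Lp.compMeasurePreserving_comp_apply φ hg hf).symm

theorem compL_congr (hf : MeasurePreserving f μ μ) (hg : MeasurePreserving g μ μ) (h : f = g) :
    compL p f hf = compL p g hg := by
  subst h; rfl

theorem compL_commute (hf : MeasurePreserving f μ μ) (hg : MeasurePreserving g μ μ)
    (h : f ∘ g = g ∘ f) : Commute (compL p f hf) (compL p g hg) := by
  rw [Commute, SemiconjBy, compL_mul, compL_mul]
  exact compL_congr _ _ h.symm

theorem compL_id (h : f = id) (hf : MeasurePreserving f μ μ) : compL p f hf = 1 := by
  subst h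
  ext1 φ
  exact Lp.compMeasurePreserving_id_apply φ

end Composition

/-! ### Translations on `L^p(ℝ^d)` -/

section Translation

variable {d : ℕ} {p : ℝ≥0∞} [Fact (1 ≤ p)]

variable (p) in
/-- Translation on `L^p(ℝ^d)`. -/
def translation (h : Space d) :
    Lp ℝ p (volume : Measure (Space d)) →L[ℝ] Lp ℝ p (volume : Measure (Space d)) :=
  compL p (fun x => x + h) (measurePreserving_add_right volume h)

theorem isTranslationGroup_translation (hp : p ≠ ∞) :
    IsTranslationGroup (translation (d := d) p) where
  zero := compL_id (funext fun x => add_zero x) _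
  add a b := by
    rw [translation, translation, translation, compL_mul]
    exact compL_congr _ _ (funext fun x => by simp [add_assoc])
  norm_le a x := (norm_compL_apply _ _).le
  continuous_apply η := by
    have hg : Continuous fun h : Space d => (⟨fun x => x + h, by fun_prop⟩ : C(Space d, Space d)) :=
      ContinuousMap.continuous_of_continuous_uncurry _
        (continuous_snd.add continuous_fst)
    exact (continuous_const (y := η)).compMeasurePreservingLp hg
      (fun h => measurePreserving_add_right volume h) hp

end Translation

/-! ### Translations in the physical variable on `L^p(Ω × ℝ^d)` -/

section FieldTranslation

variable {d : ℕ} {Ω : Type*} [MeasurableSpace Ω] {P : Measure Ω} [IsProbabilityMeasure P]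
  {p : ℝ≥0∞} [Fact (1 ≤ p)]

variable (P p) in
/-- Translation in the physical variable on `L^p(Ω × ℝ^d)`. -/
def fieldTranslation (h : Space d) : LpField d P p →L[ℝ] LpField d P p :=
  compL p (Prod.map id fun x => x + h)
    ((MeasurePreserving.id P).prod (measurePreserving_add_right volume h))

theorem fieldTranslation_tensor (hp : p ≠ ∞) (h : Space d) (φ : Lp ℝ p P)
    (η : Lp ℝ p (volume : Measure (Space d))) :
    fieldTranslation P p h (tensor P volume p hp φ η) =
      tensor P volume p hp φ (translation p h η) := by
  have hm := (MeasurePreserving.id P).prod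
    (measurePreserving_add_right (volume : Measure (Space d)) h)
  refine Lp.ext ?_
  filter_upwards [coeFn_compL (p := p) hm (tensor P volume p hp φ η),
    hm.quasiMeasurePreserving.ae (coeFn_tensor hp φ η),
    coeFn_tensor hp φ (translation p h η),
    ae_snd (μ := P) (coeFn_compL (measurePreserving_add_right (volume : Measure (Space d)) h) η)]
    with z h1 h2 h3 h4
  rw [h3]
  refine h1.trans (h2.trans ?_)
  rw [translation, h4]
  rfl

/-- Strong continuity reduces to `L^p(ℝ^d)` on tensors. It extends to all fields by uniform
approximation, because the tensors span a dense subspace and the translations are isometries. -/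
theorem isTranslationGroup_fieldTranslation {q : ℝ≥0∞} (hp : p ≠ ∞)
    (hpq : p.toReal.HolderConjugate q.toReal) :
    IsTranslationGroup (fieldTranslation (d := d) P p) where
  zero := compL_id (funext fun x => by simp [Prod.map]) _
  add a b := by
    rw [fieldTranslation, fieldTranslation, fieldTranslation, compL_mul]
    exact compL_congr _ _ (funext fun x => by simp [Prod.map, add_assoc])
  norm_le a x := (norm_compL_apply _ _).le
  continuous_apply U := by
    have hU : U ∈ (⊤ : Submodule ℝ (LpField d P p)) := trivial
    rw [← topologicalClosure_span_tensor (μ := P) (ν := (volume : Measure (Space d))) hp hpq] at hU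
    have hU' : U ∈ closure ((Submodule.span ℝ (Set.range fun x : Lp ℝ p P ×
      Lp ℝ p (volume : Measure (Space d)) => tensor P volume p hp x.1 x.2) :
        Submodule ℝ (LpField d P p)) : Set (LpField d P p)) := hU
    refine continuous_of_uniform_approx_of_continuous fun u hu => ?_
    obtain ⟨δ, hδ, hu⟩ := Metric.mem_uniformity_dist.1 hu
    obtain ⟨V, hV, hUV⟩ := Metric.mem_closure_iff.1 hU' δ hδ
    refine ⟨fun a => fieldTranslation P p a V, ?_, fun a => hu ?_⟩
    · clear hUV
      induction hV using Submodule.span_induction with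
      | mem x hx =>
        obtain ⟨⟨φ, η⟩, rfl⟩ := hx
        simp only [fieldTranslation_tensor]
        exact (tensor P volume p hp φ).continuous.comp
          ((isTranslationGroup_translation hp).continuous_apply η)
      | zero => simpa using continuous_const
      | add x y _ _ hx hy => simp only [map_add]; exact hx.add hy
      | smul c x _ hx => simp only [map_smul]; exact hx.const_smul c
    · rwa [dist_eq_norm, ← map_sub, fieldTranslation, norm_compL_apply, ← dist_eq_norm]

end FieldTranslation

/-! ### Shifts in the probability variable -/

section Shift

variable {d : ℕ} {Ω : Type*} [MeasurableSpace Ω] {P : Measure Ω} {p : ℝ≥0∞} [Fact (1 ≤ p)]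
  [IsProbabilityMeasure P] [AddAction (Lattice d) Ω] [MeasurableConstVAdd (Lattice d) Ω]
  [VAddInvariantMeasure (Lattice d) Ω P]

variable (P p) in
/-- The shift `φ ↦ φ ∘ T_z` on `L^p(Ω)` as a bounded operator. -/
def shiftL (z : Lattice d) : Lp ℝ p P →L[ℝ] Lp ℝ p P :=
  compL p (fun ω : Ω => z +ᵥ ω) (measurePreserving_vadd z P)

variable (P p) in
/-- The shift on `L^p(Ω × ℝ^d)` as a bounded operator. -/
def fieldShiftL (z : Lattice d) : LpField d P p →L[ℝ] LpField d P p :=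
  compL p (Prod.map (fun ω : Ω => z +ᵥ ω) id)
    ((measurePreserving_vadd z P).prod (MeasurePreserving.id volume))

theorem fieldShiftL_tensor (hp : p ≠ ∞) (z : Lattice d) (φ : Lp ℝ p P)
    (η : Lp ℝ p (volume : Measure (Space d))) :
    fieldShiftL P p z (tensor P volume p hp φ η) = tensor P volume p hp (shiftL P p z φ) η := by
  have hm := (measurePreserving_vadd z P).prod
    (MeasurePreserving.id (volume : Measure (Space d)))
  refine Lp.ext ?_
  filter_upwards [coeFn_compL (p := p) hm (tensor P volume p hp φ η),
    hm.quasiMeasurePreserving.ae (coeFn_tensor hp φ η),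
    coeFn_tensor hp (shiftL P p z φ) η,
    ae_fst (ν := (volume : Measure (Space d))) (coeFn_compL (measurePreserving_vadd z P) φ)]
    with x h1 h2 h3 h4
  rw [h3]
  refine h1.trans (h2.trans ?_)
  rw [shiftL, h4]
  rfl

omit [IsProbabilityMeasure P] in
theorem shiftL_add (z z' : Lattice d) : shiftL P p (z + z') = shiftL P p z * shiftL P p z' := by
  rw [shiftL, shiftL, shiftL, compL_mul]
  exact compL_congr _ _ (funext fun ω => by simp [add_comm z, add_vadd])

omit [IsProbabilityMeasure P] in
theorem shiftL_commute (z z' : Lattice d) : Commute (shiftL P p z) (shiftL P p z') := by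
  rw [Commute, SemiconjBy, ← shiftL_add, ← shiftL_add, add_comm]

theorem fieldShiftL_commute (z z' : Lattice d) :
    Commute (fieldShiftL P p z) (fieldShiftL P p z') :=
  compL_commute _ _ (funext fun x => by simp [Prod.map, vadd_vadd, add_comm])

theorem fieldShiftL_commute_fieldTranslation (z : Lattice d) (h : Space d) :
    Commute (fieldShiftL P p z) (fieldTranslation P p h) :=
  compL_commute _ _ (funext fun x => by simp [Prod.map])

-- The `z` whose shift fixes `φ` form a subgroup, and the unit vectors generate `ℤ^d`.
omit [IsProbabilityMeasure P] in
theorem mem_LpInv_iff {φ : Lp ℝ p P} :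
    φ ∈ LpInv d P p ↔ φ ∈ fixedSpace fun i : Fin d => shiftL P p (unitVec i) := by
  rw [mem_fixedSpace, LpInv, Submodule.mem_iInf]
  refine ⟨fun h i => h (unitVec i), fun h => ?_⟩
  let H : AddSubgroup (Lattice d) :=
    { carrier := {z | shiftL P p z φ = φ}
      add_mem' := fun {a b} ha hb => by
        change shiftL P p (a + b) φ = φ
        rw [shiftL_add, mul_apply_eq_comp, show shiftL P p b φ = φ from hb]
        exact ha
      zero_mem' := by
        change shiftL P p 0 φ = φ
        rw [shiftL, compL_id (funext fun ω => zero_vadd _ ω)]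
        rfl
      neg_mem' := fun {a} ha => by
        change shiftL P p (-a) φ = φ
        have h0 : shiftL P p (-a) (shiftL P p a φ) = φ := by
          rw [← mul_apply_eq_comp, ← shiftL_add, shiftL,
            compL_id (funext fun ω => by rw [neg_add_cancel, zero_vadd, id])]
          rfl
        rwa [show shiftL P p a φ = φ from ha] at h0 }
  intro z
  have hz : z ∈ H := by
    have : z = ∑ i, z i • unitVec i := by
      ext j
      simp [unitVec, Finset.sum_apply, Pi.single_apply]
    rw [this]
    exact AddSubgroup.sum_mem _ fun i _ => AddSubgroup.zsmul_mem _ (h i) _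
  exact hz

end Shift

/-! ### Weak gradients of mollified functions -/

section WeakGradient

variable {d : ℕ} {p q : ℝ≥0∞} [Fact (1 ≤ p)]

/-- A limit of difference quotients in `L^p` is a weak derivative. -/
theorem integral_mul_partialDeriv_of_tendsto (hpq : p.toReal.HolderConjugate q.toReal)
    {f g : Lp ℝ p (volume : Measure (Space d))} (i : Fin d) {t : ℕ → ℝ}
    (ht : Tendsto t atTop (𝓝 0)) (ht0 : ∀ n, t n ≠ 0)
    (h : Tendsto (fun n => (t n)⁻¹ • (translation p (t n • EuclideanSpace.single i 1) f - f)) atTop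
      (𝓝 g)) {ψ : Space d → ℝ} (hψ : IsMollifier ψ) :
    ∫ x, f x * partialDeriv i ψ x = -∫ x, g x * ψ x := by
  have hpq' : p.HolderConjugate q := ENNReal.HolderConjugate.of_toReal hpq
  have : Fact (1 ≤ q) := ⟨hpq'.symm.one_le⟩
  set e : Space d := EuclideanSpace.single i 1 with he
  have hψq : MemLp ψ q (volume : Measure (Space d)) :=
    hψ.contDiff.continuous.memLp_of_hasCompactSupport hψ.hasCompactSupport
  set Λ : Lp ℝ p (volume : Measure (Space d)) →L[ℝ] ℝ :=
    ((ContinuousLinearMap.mul ℝ ℝ).lpPairing volume p q).flip (hψq.toLp ψ) with hΛ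
  have hΛa : ∀ F : Lp ℝ p (volume : Measure (Space d)), Λ F = ∫ x, F x * ψ x := fun F => by
    rw [hΛ, ContinuousLinearMap.flip_apply, ContinuousLinearMap.lpPairing_eq_integral]
    refine integral_congr_ae ?_
    filter_upwards [hψq.coeFn_toLp] with x hx
    simp [hx]
  have hfi : ∀ {φ : Space d → ℝ}, MemLp φ q (volume : Measure (Space d)) →
      Integrable fun x => f x * φ x := fun hφ => (Lp.memLp f).integrable_mul hφ
  have hψt : ∀ a : Space d, MemLp (fun x => ψ (x + a)) q (volume : Measure (Space d)) := fun a =>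
    hψq.comp_measurePreserving (measurePreserving_add_right volume a)
  have heq : ∀ n, Λ ((t n)⁻¹ • (translation p (t n • e) f - f)) =
      ∫ x, f x * ((t n)⁻¹ * (ψ (x + (-t n) • e) - ψ x)) := by
    intro n
    -- Translation invariance of Lebesgue measure moves the translation onto `ψ` with reversed sign.
    have h1 : Λ (translation p (t n • e) f) = ∫ x, f x * ψ (x + (-t n) • e) := by
      rw [hΛa, ← integral_add_right_eq_self (fun x => f x * ψ (x + (-t n) • e)) (t n • e)]
      refine integral_congr_ae ?_
      filter_upwards [coeFn_compL (measurePreserving_add_right (volume : Measure (Space d))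
        (t n • e)) f] with x hx
      rw [translation, hx]
      simp [add_assoc]
    rw [map_smul, map_sub, h1, hΛa, ← integral_sub (hfi (hψt _)) (hfi hψq), smul_eq_mul,
      ← integral_const_mul]
    refine integral_congr_ae (ae_of_all _ fun x => ?_)
    simp only
    ring
  have hlim1 := (Λ.continuous.tendsto g).comp h
  obtain ⟨C, K, hK, hb⟩ := hψ.exists_diffQuot_bound i
  have hlim2 : Tendsto (fun n => ∫ x, f x * ((t n)⁻¹ * (ψ (x + (-t n) • e) - ψ x))) atTop
      (𝓝 (∫ x, f x * -partialDeriv i ψ x)) := by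
    refine tendsto_integral_filter_of_dominated_convergence
      (fun x => |f x * K.indicator (fun _ => C) x|) (Eventually.of_forall fun n => ?_) ?_ ?_ ?_
    · exact (hfi (((hψt _).sub hψq).const_mul (t n)⁻¹)).aestronglyMeasurable
    · have : ∀ᶠ n in atTop, |t n| ≤ 1 := by
        have := ht.abs
        rw [abs_zero] at this
        exact this.eventually_le_const one_pos
      filter_upwards [this] with n hn
      refine ae_of_all _ fun x => ?_
      have h2 := hb (-t n) x (by rwa [abs_neg])
      rw [inv_neg, neg_mul, norm_neg] at h2
      rw [norm_mul, abs_mul]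
      exact mul_le_mul_of_nonneg_left (h2.trans (le_abs_self _)) (abs_nonneg _)
    · exact (hfi (memLp_indicator_const q hK.measurableSet C (Or.inr hK.measure_lt_top.ne))).abs
    · refine ae_of_all _ fun x => Tendsto.const_mul _ ?_
      have h2 := (hψ.tendsto_diffQuot i (t := fun n => -t n) (by simpa using ht.neg)
        (fun n => neg_ne_zero.2 (ht0 n)) x).neg
      simpa [he, inv_neg, neg_mul] using h2
  have h3 := tendsto_nhds_unique hlim1 (hlim2.congr fun n => (heq n).symm)
  rw [hΛa] at h3
  simp only [mul_neg, integral_neg] at h3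
  rw [h3, neg_neg]

/-- The difference quotients of a mollified function converge in `L^p` by
`tendsto_mollify_diffQuot`, and such a limit is a weak derivative. -/
theorem isWeakGrad_mollify (hp : p ≠ ∞) (hpq : p.toReal.HolderConjugate q.toReal)
    {ρ : Space d → ℝ} (hρ : IsMollifier ρ) (η : Lp ℝ p (volume : Measure (Space d))) :
    IsWeakGrad (mollify (isTranslationGroup_translation hp) hρ.integrable η) fun i =>
      -mollify (isTranslationGroup_translation hp) (hρ.integrable_partialDeriv i) η := by
  intro i ψ hψ hψc
  have ht : Tendsto (fun n : ℕ => 1 / ((n : ℝ) + 1)) atTop (𝓝 0) :=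
    tendsto_one_div_add_atTop_nhds_zero_nat
  have ht0 : ∀ n : ℕ, 1 / ((n : ℝ) + 1) ≠ 0 := fun n => by positivity
  have hT := tendsto_mollify_diffQuot (isTranslationGroup_translation (d := d) hp) hρ i ht ht0
  have hT' := ((ContinuousLinearMap.apply ℝ (Lp ℝ p (volume : Measure (Space d))) η).continuous.tendsto
    _).comp hT
  exact integral_mul_partialDeriv_of_tendsto hpq i ht ht0 hT'
    ⟨hψ.of_le (by exact_mod_cast le_top), hψc⟩

end WeakGradient

/-! ### The tensor product spaces -/

section TensorSpaces

variable {d : ℕ} {Ω : Type*} [MeasurableSpace Ω] {P : Measure Ω} {p q : ℝ≥0∞} [Fact (1 ≤ p)]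
  [IsProbabilityMeasure P] [AddAction (Lattice d) Ω] [MeasurableConstVAdd (Lattice d) Ω]
  [VAddInvariantMeasure (Lattice d) Ω P]

omit [IsProbabilityMeasure P] [AddAction (Lattice d) Ω] [MeasurableConstVAdd (Lattice d) Ω]
  [VAddInvariantMeasure (Lattice d) Ω P] in
theorem isTensor_iff (hp : p ≠ ∞) {φ : Lp ℝ p P} {η : Lp ℝ p (volume : Measure (Space d))}
    {F : LpField d P p} : IsTensor φ η F ↔ F = tensor P volume p hp φ η := by
  refine ⟨fun h => Lp.ext (h.trans (coeFn_tensor hp φ η).symm), ?_⟩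
  rintro rfl
  exact coeFn_tensor hp φ η

variable (d P p) in
/-- The shifts by the unit vectors on `L^p(Ω)`. -/
def unitShift (i : Fin d) : Lp ℝ p P →L[ℝ] Lp ℝ p P := shiftL P p (unitVec i)

variable (d P p) in
/-- The shifts by the unit vectors on `L^p(Ω × ℝ^d)`. -/
def unitFieldShift (i : Fin d) : LpField d P p →L[ℝ] LpField d P p := fieldShiftL P p (unitVec i)

theorem norm_unitFieldShift_le (i : Fin d) : ‖unitFieldShift d P p i‖ ≤ 1 := norm_compL_le _

theorem unitFieldShift_commute (i j : Fin d) :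
    Commute (unitFieldShift d P p i) (unitFieldShift d P p j) := fieldShiftL_commute _ _

theorem unitFieldShift_commute_fieldTranslation (i : Fin d) (h : Space d) :
    Commute (unitFieldShift d P p i) (fieldTranslation P p h) :=
  fieldShiftL_commute_fieldTranslation _ _

theorem unitFieldShift_tensor (hp : p ≠ ∞) (i : Fin d) (φ : Lp ℝ p P)
    (η : Lp ℝ p (volume : Measure (Space d))) :
    unitFieldShift d P p i (tensor P volume p hp φ η) =
      tensor P volume p hp (unitShift d P p i φ) η := fieldShiftL_tensor hp _ φ η

omit [IsProbabilityMeasure P] in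
theorem tensor_mem_invTensorLp (hp : p ≠ ∞) {φ : Lp ℝ p P}
    (hφ : φ ∈ fixedSpace (unitShift d P p)) (η : Lp ℝ p (volume : Measure (Space d))) :
    tensor P volume p hp φ η ∈ invTensorLp d P p :=
  Submodule.le_topologicalClosure _ (Submodule.subset_span
    ⟨φ, mem_LpInv_iff.2 hφ, η, (isTensor_iff hp).2 rfl⟩)

omit [IsProbabilityMeasure P] in
/-- To prove that a closed subspace contains `L^p_inv(Ω) ⊗ L^p(ℝ^d)` it suffices to consider
tensors. -/
theorem invTensorLp_le (hp : p ≠ ∞) {M : Submodule ℝ (LpField d P p)}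
    (hM : IsClosed (M : Set (LpField d P p)))
    (h : ∀ φ ∈ fixedSpace (unitShift d P p), ∀ η, tensor P volume p hp φ η ∈ M) :
    invTensorLp d P p ≤ M := by
  refine Submodule.topologicalClosure_minimal _ (Submodule.span_le.2 ?_) hM
  rintro F ⟨φ, hφ, η, hF⟩
  rw [isTensor_iff hp] at hF
  subst hF
  exact h φ (mem_LpInv_iff.1 hφ) η

theorem invTensorLp_le_fixedSpace (hp : p ≠ ∞) :
    invTensorLp d P p ≤ fixedSpace (unitFieldShift d P p) :=
  invTensorLp_le hp isClosed_fixedSpace fun φ hφ η => mem_fixedSpace.2 fun i => by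
    rw [unitFieldShift_tensor, mem_fixedSpace.1 hφ]

/-- Decomposing the factor `φ` of each tensor ergodically shows that invariant tensors and
coboundaries together are dense. If `y + z` of this kind approximates a fixed `U`, then `‖U - y‖ ≤
‖U - y - z‖`, so `y` alone does. -/
theorem fixedSpace_le_invTensorLp (hp : p ≠ ∞) (hpq : p.toReal.HolderConjugate q.toReal)
    (hP : HasWeakCompactness (Lp ℝ p P)) :
    fixedSpace (unitFieldShift d P p) ≤ invTensorLp d P p := by
  intro U hU
  set Z := (coboundarySpan (unitFieldShift d P p)).topologicalClosure with hZ
  have htop : (invTensorLp d P p ⊔ Z).topologicalClosure = ⊤ := by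
    rw [eq_top_iff,
      ← topologicalClosure_span_tensor (μ := P) (ν := (volume : Measure (Space d))) hp hpq]
    refine Submodule.topologicalClosure_mono (Submodule.span_le.2 ?_)
    rintro _ ⟨⟨φ, η⟩, rfl⟩
    obtain ⟨a, ha, hz⟩ := exists_fixed_add_coboundary hP (S := unitShift d P p)
      (fun i j => shiftL_commute _ _) (fun i => norm_compL_le _) φ
    have h1 : (coboundarySpan (unitShift d P p)).topologicalClosure ≤
        Z.comap ((tensor P volume p hp).flip η).toLinearMap := by
      refine Submodule.topologicalClosure_minimal _ (coboundarySpan_le fun i x => ?_)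
        ((Submodule.isClosed_topologicalClosure _).preimage
          ((tensor P volume p hp).flip η).continuous)
      change tensor P volume p hp (unitShift d P p i x - x) η ∈ Z
      rw [map_sub, sub_apply, ← unitFieldShift_tensor]
      exact Submodule.le_topologicalClosure _ (sub_mem_coboundarySpan i _)
    have h2 : tensor P volume p hp (φ - a) η ∈ Z := h1 hz
    have h3 : tensor P volume p hp φ η =
        tensor P volume p hp a η + tensor P volume p hp (φ - a) η := by
      rw [map_sub, sub_apply, add_sub_cancel]
    change tensor P volume p hp φ η ∈ invTensorLp d P p ⊔ Z
    rw [h3]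
    exact Submodule.add_mem_sup (tensor_mem_invTensorLp hp ha η) h2
  have hU' : U ∈ closure ((invTensorLp d P p ⊔ Z : Submodule ℝ (LpField d P p)) :
      Set (LpField d P p)) := by
    rw [← Submodule.topologicalClosure_coe, htop]
    trivial
  have hcl : IsClosed (invTensorLp d P p : Set (LpField d P p)) :=
    Submodule.isClosed_topologicalClosure _
  rw [← SetLike.mem_coe, ← hcl.closure_eq]
  refine Metric.mem_closure_iff.2 fun δ hδ => ?_
  obtain ⟨V, hV, hUV⟩ := Metric.mem_closure_iff.1 hU' δ hδ
  obtain ⟨y, hy, z, hz, rfl⟩ := Submodule.mem_sup.1 hV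
  refine ⟨y, hy, lt_of_le_of_lt ?_ hUV⟩
  rw [dist_eq_norm, dist_eq_norm]
  refine (norm_le_norm_add_coboundary unitFieldShift_commute norm_unitFieldShift_le
    (Submodule.sub_mem _ hU (invTensorLp_le_fixedSpace hp hy)) (Submodule.neg_mem _ hz)).trans ?_
  rw [← sub_eq_add_neg, sub_sub]

omit [AddAction (Lattice d) Ω] [MeasurableConstVAdd (Lattice d) Ω]
  [VAddInvariantMeasure (Lattice d) Ω P] in
theorem mollify_tensor (hp : p ≠ ∞) (hpq : p.toReal.HolderConjugate q.toReal) {ρ : Space d → ℝ}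
    (hρ : Integrable ρ) (φ : Lp ℝ p P) (η : Lp ℝ p (volume : Measure (Space d))) :
    mollify (isTranslationGroup_fieldTranslation hp hpq) hρ (tensor P volume p hp φ η) =
      tensor P volume p hp φ (mollify (isTranslationGroup_translation hp) hρ η) :=
  (map_mollify _ _ hρ (tensor P volume p hp φ)
    (fun h η => (fieldTranslation_tensor hp h φ η).symm) η).symm

/-- An invariant field with an `L^p` gradient belongs to `L^p_inv(Ω) ⊗ W^{1,p}(ℝ^d)`. -/
theorem mem_invTensorSobolev (hp : p ≠ ∞) (hpq : p.toReal.HolderConjugate q.toReal)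
    {U : LpField d P p} (hU : U ∈ invTensorLp d P p) {G : Fin d → LpField d P p}
    (hG : ∀ (ρ : Space d → ℝ) (hρ : IsMollifier ρ) (i : Fin d),
      mollify (isTranslationGroup_fieldTranslation hp hpq) hρ.integrable (G i) =
        -mollify (isTranslationGroup_fieldTranslation hp hpq) (hρ.integrable_partialDeriv i) U) :
    (U, G) ∈ invTensorSobolev d P p := by
  set hτ := isTranslationGroup_fieldTranslation (d := d) (P := P) hp hpq
  have hcl : IsClosed (invTensorSobolev d P p :
      Set (LpField d P p × (Fin d → LpField d P p))) :=
    Submodule.isClosed_topologicalClosure _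
  have hmem : ∀ (ρ : Space d → ℝ) (hρ : IsMollifier ρ),
      (mollify hτ hρ.integrable U, fun i => -mollify hτ (hρ.integrable_partialDeriv i) U) ∈
        invTensorSobolev d P p := by
    intro ρ hρ
    -- The map sending `U` to its mollification and the gradient of that. It is continuous, so its
    -- values on `L^p_inv ⊗ L^p` are controlled by tensors, where only `η` is mollified.
    let J : LpField d P p →L[ℝ] LpField d P p × (Fin d → LpField d P p) :=
      (mollify hτ hρ.integrable).prod
        (ContinuousLinearMap.pi fun i => -mollify hτ (hρ.integrable_partialDeriv i))
    have hle : invTensorLp d P p ≤ (invTensorSobolev d P p).comap J.toLinearMap := by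
      refine invTensorLp_le hp (hcl.preimage J.continuous) fun φ hφ η => ?_
      refine Submodule.le_topologicalClosure _ (Submodule.subset_span
        ⟨φ, mem_LpInv_iff.2 hφ, _, _, isWeakGrad_mollify hp hpq hρ η, ?_, fun i => ?_⟩)
      · exact (isTensor_iff hp).2 (mollify_tensor hp hpq _ φ η)
      · refine (isTensor_iff hp).2 ?_
        change -mollify hτ (hρ.integrable_partialDeriv i) (tensor P volume p hp φ η) = _
        rw [mollify_tensor hp hpq, map_neg]
    exact hle hU
  obtain ⟨ρ, hρ, hlim⟩ := exists_mollifier_tendsto hτ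
  refine hcl.mem_of_tendsto (f := fun n => (mollify hτ (hρ n).integrable U,
    fun i => mollify hτ (hρ n).integrable (G i))) (b := atTop)
    ((hlim U).prodMk_nhds (tendsto_pi_nhds.2 fun i => hlim (G i)))
    (Eventually.of_forall fun n => ?_)
  simp only [hG (ρ n) (hρ n)]
  exact hmem (ρ n) (hρ n)

/-- Membership in `L^p_pot(Ω) ⊗ L^p(ℝ^d)` by duality. -/
theorem mem_potTensorLp (hp : p ≠ ∞) (hpq : p.toReal.HolderConjugate q.toReal)
    {χ : Fin d → LpField d P p}
    (h : ∀ ℓ : Fin d → LpField d P p →L[ℝ] ℝ,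
      (∀ x, ∑ i, ℓ i (unitFieldShift d P p i x - x) = 0) → ∑ i, ℓ i (χ i) = 0) :
    χ ∈ potTensorLp d P p := by
  classical
  refine mem_of_forall_dual_eq_zero (Submodule.isClosed_topologicalClosure _) fun L hL => ?_
  set ℓ : Fin d → LpField d P p →L[ℝ] ℝ := fun i =>
    L.comp (ContinuousLinearMap.single ℝ (fun _ => LpField d P p) i) with hℓ
  have hsum : ∀ F, L F = ∑ i, ℓ i (F i) := fun F => by
    conv_lhs => rw [← Finset.univ_sum_single F, map_sum]
    rfl
  rw [hsum]
  refine h ℓ fun x => ?_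
  -- `L` vanishes on `Dφ ⊗ η`, which is the horizontal derivative of `φ ⊗ η`; density of tensors
  -- gives admissibility of `ℓ` on all fields.
  have h0 : (∑ i, (ℓ i).comp (unitFieldShift d P p i - 1)) = 0 := by
    refine dual_eq_zero_of_tensor hp hpq fun φ η => ?_
    have h1 : (fun i => unitFieldShift d P p i (tensor P volume p hp φ η) -
        tensor P volume p hp φ η) ∈ potTensorLp d P p := by
      refine Submodule.le_topologicalClosure _ (Submodule.subset_span
        ⟨horizontalGrad P p φ, Submodule.le_topologicalClosure _ ⟨φ, rfl⟩, η, fun i => ?_⟩)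
      rw [isTensor_iff hp]
      change unitFieldShift d P p i (tensor P volume p hp φ η) - tensor P volume p hp φ η =
        tensor P volume p hp (unitShift d P p i φ - φ) η
      rw [map_sub, sub_apply, unitFieldShift_tensor]
    have h2 := hL _ h1
    rw [hsum] at h2
    simpa using h2
  have h3 := DFunLike.congr_fun h0 x
  simpa using h3

end TensorSpaces

/-! ### The unfolding operator -/

section Unfolding

variable {d : ℕ}

instance sFinite_latticeMeasure (ε : ℝ) : SFinite (latticeMeasure d ε) := by
  unfold latticeMeasure; infer_instance

theorem measurable_roundIndex (ε : ℝ) : Measurable (roundIndex (d := d) ε) := by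
  unfold roundIndex
  refine measurable_pi_iff.2 fun i => Int.measurable_floor.comp ?_
  have : Measurable fun x : Space d => x i := by fun_prop
  exact (this.div_const ε).add_const _

/-- Each fibre is a half-open cube of side `ε`, whose volume `ε^d` is the mass of a lattice point.
-/
theorem measurePreserving_roundIndex {ε : ℝ} (hε : 0 < ε) :
    MeasurePreserving (roundIndex (d := d) ε) volume (latticeMeasure d ε) := by
  refine ⟨measurable_roundIndex ε, Measure.ext_of_singleton fun z => ?_⟩
  rw [Measure.map_apply (measurable_roundIndex ε) (measurableSet_singleton z), latticeMeasure,
    Measure.smul_apply, Measure.count_singleton, smul_eq_mul, mul_one]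
  have hpre : roundIndex ε ⁻¹' {z} = (WithLp.ofLp : Space d → Fin d → ℝ) ⁻¹'
      (Set.univ.pi fun i => Set.Ico (ε * ((z i : ℝ) - 1 / 2)) (ε * ((z i : ℝ) + 1 / 2))) := by
    ext x
    simp only [Set.mem_preimage, Set.mem_singleton_iff, funext_iff, roundIndex, Int.floor_eq_iff,
      Set.mem_pi, Set.mem_univ, true_imp_iff, Set.mem_Ico]
    refine forall_congr' fun i => ?_
    have h1 : (z i : ℝ) ≤ x i / ε + 1 / 2 ↔ ε * ((z i : ℝ) - 1 / 2) ≤ x i := by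
      rw [← sub_le_iff_le_add, le_div_iff₀ hε, mul_comm]
    have h2 : x i / ε + 1 / 2 < (z i : ℝ) + 1 ↔ x i < ε * ((z i : ℝ) + 1 / 2) := by
      rw [← lt_sub_iff_add_lt, div_lt_iff₀ hε, mul_comm]
      ring_nf
    rw [h1, h2]
  rw [hpre, (PiLp.volume_preserving_ofLp (Fin d)).measure_preimage
    (MeasurableSet.univ_pi fun i => measurableSet_Ico).nullMeasurableSet, Real.volume_pi_Ico]
  have : ∀ i, ε * ((z i : ℝ) + 1 / 2) - ε * ((z i : ℝ) - 1 / 2) = ε := fun i => by ring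
  simp only [this, Finset.prod_const, Finset.card_univ, Fintype.card_fin]
  rw [ENNReal.ofReal_pow hε.le]

theorem roundIndex_add_single {ε : ℝ} (hε : 0 < ε) (x : Space d) (i : Fin d) :
    roundIndex ε (x + ε • EuclideanSpace.single i 1) = roundIndex ε x + unitVec i := by
  ext j
  simp only [roundIndex, unitVec, Pi.add_apply]
  rcases eq_or_ne j i with rfl | hj
  · have : (x + ε • (EuclideanSpace.single j 1 : Space d)) j / ε + 1 / 2 =
        (x j / ε + 1 / 2) + (1 : ℤ) := by
      simp
      field_simp
      ring
    rw [this, Int.floor_add_intCast, Pi.single_eq_same]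
  · simp [hj]

variable {Ω : Type*} [MeasurableSpace Ω] {P : Measure Ω} {p : ℝ≥0∞}
  [IsProbabilityMeasure P] [AddAction (Lattice d) Ω] [MeasurableConstVAdd (Lattice d) Ω]
  [VAddInvariantMeasure (Lattice d) Ω P]

/-- The map underlying the unfolding operator. -/
def unfoldMap (ε : ℝ) (z : Ω × Space d) : Ω × Lattice d :=
  (-(roundIndex ε z.2) +ᵥ z.1, roundIndex ε z.2)

/-- A skew product over the rounding map with `P`-preserving fibre maps; the swaps put the base in
the first factor. -/
theorem measurePreserving_unfoldMap {ε : ℝ} (hε : 0 < ε) :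
    MeasurePreserving (unfoldMap (Ω := Ω) (d := d) ε) (P.prod volume)
      (P.prod (latticeMeasure d ε)) := by
  have hm : Measurable (Function.uncurry fun (x : Space d) (ω : Ω) => -(roundIndex ε x) +ᵥ ω) := by
    have h1 : Measurable fun y : Lattice d × Ω => -y.1 +ᵥ y.2 :=
      measurable_from_prod_countable_right fun z => measurable_const_vadd (-z)
    exact h1.comp ((measurable_roundIndex ε).prodMap measurable_id)
  have h := (measurePreserving_roundIndex (d := d) hε).skew_product hm
    (ae_of_all _ fun x => (measurePreserving_vadd (-(roundIndex ε x)) P).map_eq)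
  exact Measure.measurePreserving_swap.comp (h.comp Measure.measurePreserving_swap)

omit [MeasurableSpace Ω] [MeasurableConstVAdd (Lattice d) Ω] in
theorem unfold_eq_comp (ε : ℝ) (u : Ω × Lattice d → ℝ) : unfold ε u = u ∘ unfoldMap ε := rfl

theorem memLp_unfold {ε : ℝ} (hε : 0 < ε) {u : Ω × Lattice d → ℝ}
    (hu : MemLp u p (P.prod (latticeMeasure d ε))) : MemLp (unfold ε u) p (P.prod volume) :=
  hu.comp_measurePreserving (measurePreserving_unfoldMap hε)

-- Moving `x` by `ε e_i` raises the rounded index by `e_i`; shifting `ω` by `e_i` as well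
-- compensates for this in the argument `-z +ᵥ ω`.
omit [MeasurableSpace Ω] [MeasurableConstVAdd (Lattice d) Ω] in
theorem unfold_discreteDeriv {ε : ℝ} (hε : 0 < ε) (i : Fin d) (u : Ω × Lattice d → ℝ) :
    unfold ε (discreteDeriv ε i u) = fun z : Ω × Space d =>
      ε⁻¹ * (unfold ε u (unitVec i +ᵥ z.1, z.2 + ε • EuclideanSpace.single i 1) -
        unfold ε u z) := by
  ext z
  simp only [unfold, discreteDeriv, roundIndex_add_single hε, vadd_vadd]
  rw [neg_add, neg_add_cancel_right, div_eq_inv_mul]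

variable [Fact (1 ≤ p)]

theorem unitFieldShift_axisShift_toLp (ε : ℝ) (i : Fin d) {v : Ω × Space d → ℝ}
    (hv : MemLp v p (P.prod volume)) :
    (unitFieldShift d P p i (axisShift (fieldTranslation P p) ε i (hv.toLp v)) : LpField d P p)
      =ᵐ[P.prod volume] fun z => v (unitVec i +ᵥ z.1, z.2 + ε • EuclideanSpace.single i 1) := by
  have hm := (measurePreserving_vadd (unitVec i : Lattice d) P).prod
    (MeasurePreserving.id (volume : Measure (Space d)))
  have hm' := (MeasurePreserving.id P).prod
    (measurePreserving_add_right (volume : Measure (Space d)) (ε • EuclideanSpace.single i 1))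
  filter_upwards [coeFn_compL (p := p) hm (axisShift (fieldTranslation P p) ε i (hv.toLp v)),
    hm.quasiMeasurePreserving.ae (coeFn_compL (p := p) hm' (hv.toLp v)),
    hm.quasiMeasurePreserving.ae (hm'.quasiMeasurePreserving.ae hv.coeFn_toLp)] with z h1 h2 h3
  exact h1.trans (h2.trans h3)

theorem exists_memLp_unfold_discreteDeriv {ε : ℝ} (hε : 0 < ε) (i : Fin d)
    {u : Ω × Lattice d → ℝ} (hu : MemLp (unfold ε u) p (P.prod volume)) (c : ℝ) :
    ∃ h : MemLp (unfold ε (c • discreteDeriv ε i u)) p (P.prod volume),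
      h.toLp _ = c • ε⁻¹ • (unitFieldShift d P p i (axisShift (fieldTranslation P p) ε i
        (hu.toLp _)) - hu.toLp _) := by
  set F : LpField d P p := c • ε⁻¹ • (unitFieldShift d P p i
    (axisShift (fieldTranslation P p) ε i (hu.toLp _)) - hu.toLp _) with hF
  have hae : F =ᵐ[P.prod volume] unfold ε (c • discreteDeriv ε i u) := by
    have h0 : unfold ε (c • discreteDeriv ε i u) = c • unfold (Ω := Ω) ε (discreteDeriv ε i u) :=
      rfl
    rw [h0, unfold_discreteDeriv hε]
    filter_upwards [Lp.coeFn_smul c (ε⁻¹ • (unitFieldShift d P p i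
      (axisShift (fieldTranslation P p) ε i (hu.toLp _)) - hu.toLp _)),
      Lp.coeFn_smul ε⁻¹ (unitFieldShift d P p i
      (axisShift (fieldTranslation P p) ε i (hu.toLp _)) - hu.toLp _),
      Lp.coeFn_sub (unitFieldShift d P p i
      (axisShift (fieldTranslation P p) ε i (hu.toLp _))) (hu.toLp _),
      unitFieldShift_axisShift_toLp ε i hu, hu.coeFn_toLp] with z h1 h2 h3 h4 h5
    rw [hF, h1, Pi.smul_apply, h2, Pi.smul_apply, h3, Pi.sub_apply, h4, h5]
    rfl
  have hmem : MemLp (unfold ε (c • discreteDeriv ε i u)) p (P.prod volume) :=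
    (Lp.memLp F).ae_eq hae
  refine ⟨hmem, Lp.ext ?_⟩
  exact hmem.coeFn_toLp.trans hae.symm

omit [AddAction (Lattice d) Ω] [MeasurableConstVAdd (Lattice d) Ω]
  [VAddInvariantMeasure (Lattice d) Ω P] [Fact (1 ≤ p)] in
theorem aestronglyMeasurable_discreteDeriv (ε : ℝ) (i : Fin d) {u : Ω × Lattice d → ℝ}
    (hu : AEStronglyMeasurable u (P.prod (latticeMeasure d ε))) :
    AEStronglyMeasurable (discreteDeriv ε i u) (P.prod (latticeMeasure d ε)) := by
  have h1 : MeasurePreserving (fun z : Lattice d => z + unitVec i) (latticeMeasure d ε)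
      (latticeMeasure d ε) := by
    unfold latticeMeasure
    exact measurePreserving_add_right _ _
  have h2 := (hu.comp_measurePreserving ((MeasurePreserving.id P).prod h1)).sub hu
  have h3 := h2.const_mul ε⁻¹
  refine h3.congr (ae_of_all _ fun z => ?_)
  simp only [discreteDeriv, div_eq_inv_mul]
  rfl

/-- The unfolding preserves norms, and the product integral is at most the iterated one, so `g` need
not be measurable. -/
theorem norm_toLp_unfold_le (hp : p ≠ ∞) {ε : ℝ} (hε : 0 < ε) {f : Ω × Lattice d → ℝ}
    (hf : AEStronglyMeasurable f (P.prod (latticeMeasure d ε)))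
    (h : MemLp (unfold ε f) p (P.prod volume)) {g : Ω × Lattice d → ℝ}
    (hfg : ∀ z, |f z| ^ p.toReal ≤ g z) {K : ℝ≥0∞} (hK : K ≠ ∞)
    (hgK : ∫⁻ ω, ∫⁻ z, ENNReal.ofReal (g (ω, z)) ∂(latticeMeasure d ε) ∂P ≤ K) :
    ‖h.toLp _‖ ≤ (K ^ (1 / p.toReal)).toReal := by
  have hP : 0 < p.toReal := ENNReal.toReal_pos ne_zero_of_fact hp
  rw [Lp.norm_toLp]
  refine ENNReal.toReal_mono (ENNReal.rpow_ne_top_of_nonneg (by positivity) hK) ?_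
  rw [unfold_eq_comp, eLpNorm_comp_measurePreserving hf (measurePreserving_unfoldMap hε),
    eLpNorm_eq_lintegral_rpow_enorm_toReal ne_zero_of_fact hp]
  refine ENNReal.rpow_le_rpow (((lintegral_prod_le _).trans ?_).trans hgK) (by positivity)
  refine lintegral_mono fun ω => lintegral_mono fun z => ?_
  rw [Real.enorm_eq_ofReal_abs, ENNReal.ofReal_rpow_of_nonneg (abs_nonneg _) hP.le]
  exact ENNReal.ofReal_le_ofReal (hfg _)

end Unfolding

/-! ### Compactness -/

section MainTheorem

variable {d : ℕ} {Ω : Type*} [MeasurableSpace Ω] {P : Measure Ω} {p : ℝ≥0∞} [Fact (1 ≤ p)]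
  [IsProbabilityMeasure P] [AddAction (Lattice d) Ω] [MeasurableConstVAdd (Lattice d) Ω]
  [VAddInvariantMeasure (Lattice d) Ω P]

omit [AddAction (Lattice d) Ω] [MeasurableConstVAdd (Lattice d) Ω]
  [VAddInvariantMeasure (Lattice d) Ω P] in
theorem hasWeakCompactness_field [IsSeparable P] {q : ℝ≥0∞} [Fact (1 ≤ q)] (hp : p ≠ ∞)
    (hpq : p.toReal.HolderConjugate q.toReal) :
    HasWeakCompactness (Lp ℝ p P) ∧ HasWeakCompactness (LpField d P p) := by
  have hq : q ≠ ∞ := fun h => by simpa [h] using hpq.symm.pos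
  have : Fact (q ≠ ∞) := ⟨hq⟩
  have := separableSpace_Lp_prod (μ := P) (ν := (volume : Measure (Space d))) hq hpq.symm
  exact ⟨hasWeakCompactness_Lp hp hpq, hasWeakCompactness_Lp hp hpq⟩

variable {γ : ℝ} {ε : ℕ → ℝ} {u : ℕ → Ω × Lattice d → ℝ}

/-- Along a subsequence the unfolded functions and the unfolded rescaled gradients converge
weakly. -/
theorem exists_weak_limits (hp : p ≠ ∞) (hX : HasWeakCompactness (LpField d P p))
    (hε_pos : ∀ n, 0 < ε n)
    (hu : ∀ n, MemLp (u n) p (P.prod (latticeMeasure d (ε n))))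
    (hbound : limsup (fun n => energy P p γ (ε n) (u n)) atTop < ∞) :
    ∃ (k : ℕ → ℕ) (U : LpField d P p) (W : Fin d → LpField d P p) (C : ℝ), StrictMono k ∧
      (∀ n, ‖(memLp_unfold (hε_pos (k n)) (hu (k n))).toLp _‖ ≤ C) ∧
      (∀ i n, ‖ε (k n) ^ γ • (ε (k n))⁻¹ • (unitFieldShift d P p i (axisShift (fieldTranslation P p)
        (ε (k n)) i ((memLp_unfold (hε_pos (k n)) (hu (k n))).toLp _)) -
          (memLp_unfold (hε_pos (k n)) (hu (k n))).toLp _)‖ ≤ C) ∧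
      WeakTendsto (fun n => (memLp_unfold (hε_pos (k n)) (hu (k n))).toLp _) U ∧
      ∀ i, WeakTendsto (fun n => ε (k n) ^ γ • (ε (k n))⁻¹ • (unitFieldShift d P p i
        (axisShift (fieldTranslation P p) (ε (k n)) i
          ((memLp_unfold (hε_pos (k n)) (hu (k n))).toLp _)) -
            (memLp_unfold (hε_pos (k n)) (hu (k n))).toLp _)) (W i) := by
  have hP : 0 < p.toReal := ENNReal.toReal_pos ne_zero_of_fact hp
  set v : ℕ → LpField d P p := fun n => (memLp_unfold (hε_pos n) (hu n)).toLp _ with hv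
  set w : Fin d → ℕ → LpField d P p := fun i n => ε n ^ γ • (ε n)⁻¹ • (unitFieldShift d P p i
    (axisShift (fieldTranslation P p) (ε n) i (v n)) - v n) with hw
  -- The energies lie below `K` only from some `N` on; the sequences are shifted by `N` to be
  -- bounded for all indices.
  obtain ⟨K, hK1, hK2⟩ := exists_between hbound
  obtain ⟨N, hN⟩ := eventually_atTop.1 (eventually_lt_of_limsup_lt hK1)
  set C := (K ^ (1 / p.toReal)).toReal with hC
  have hvC : ∀ n, N ≤ n → ‖v n‖ ≤ C := fun n hn => by
    refine norm_toLp_unfold_le hp (hε_pos n) (hu n).aestronglyMeasurable _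
      (g := fun z => |u n z| ^ p.toReal +
      ε n ^ (γ * p.toReal) * ‖discreteGrad (ε n) (u n) z‖ ^ p.toReal) (fun z => ?_)
      hK2.ne (hN n hn).le
    have : 0 ≤ ε n ^ (γ * p.toReal) * ‖discreteGrad (ε n) (u n) z‖ ^ p.toReal :=
      mul_nonneg (Real.rpow_nonneg (hε_pos n).le _) (Real.rpow_nonneg (norm_nonneg _) _)
    exact le_add_of_nonneg_right this
  have hwC : ∀ i n, N ≤ n → ‖w i n‖ ≤ C := fun i n hn => by
    obtain ⟨h, heq⟩ := exists_memLp_unfold_discreteDeriv (hε_pos n) i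
      (memLp_unfold (hε_pos n) (hu n)) (ε n ^ γ)
    have h1 : w i n = h.toLp _ := heq.symm
    rw [h1]
    refine norm_toLp_unfold_le hp (hε_pos n)
      ((aestronglyMeasurable_discreteDeriv (ε n) i (hu n).aestronglyMeasurable).const_smul _) _
      (g := fun z => |u n z| ^ p.toReal +
      ε n ^ (γ * p.toReal) * ‖discreteGrad (ε n) (u n) z‖ ^ p.toReal)
      (fun z => ?_) hK2.ne (hN n hn).le
    have h2 : 0 ≤ |u n z| ^ p.toReal := Real.rpow_nonneg (abs_nonneg _) _
    have h3 : |discreteDeriv (ε n) i (u n) z| ≤ ‖discreteGrad (ε n) (u n) z‖ :=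
      PiLp.norm_apply_le (discreteGrad (ε n) (u n) z) i
    have h4 : 0 ≤ ε n ^ γ := Real.rpow_nonneg (hε_pos n).le _
    refine le_trans ?_ (le_add_of_nonneg_left h2)
    rw [Pi.smul_apply, smul_eq_mul, abs_mul, abs_of_nonneg h4,
      Real.mul_rpow h4 (abs_nonneg _), ← Real.rpow_mul (hε_pos n).le]
    have h5 : 0 ≤ ε n ^ (γ * p.toReal) := Real.rpow_nonneg (hε_pos n).le _
    gcongr
  -- `none` indexes the function and `some i` its `i`-th derivative.
  obtain ⟨m, hm, a, ha⟩ := hX.exists_common_subseq (Finset.univ : Finset (Option (Fin d)))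
    (x := fun o n => o.elim (v (n + N)) fun i => w i (n + N)) (C := C) (fun o n => by
      cases o with
      | none => exact hvC _ (Nat.le_add_left _ _)
      | some i => exact hwC i _ (Nat.le_add_left _ _))
  refine ⟨fun n => m n + N, a none, fun i => a (some i), C, fun _ _ h => Nat.add_lt_add_right (hm h) N,
    fun n => hvC _ (Nat.le_add_left _ _), fun i n => hwC i _ (Nat.le_add_left _ _),
    ha none (Finset.mem_univ _), fun i => ha (some i) (Finset.mem_univ _)⟩

end MainTheorem

/-! ### Powers of `ε` and the passage back to two-scale convergence -/

section Assembly

theorem exists_holderConjugate {p : ℝ≥0∞} (h1 : 1 < p) (hp : p ≠ ∞) :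
    ∃ q : ℝ≥0∞, 1 ≤ q ∧ p.toReal.HolderConjugate q.toReal := by
  have hr : 1 < p.toReal := by
    simpa using (ENNReal.toReal_lt_toReal ENNReal.one_ne_top hp).2 h1
  have h := Real.HolderConjugate.conjExponent hr
  refine ⟨ENNReal.ofReal p.toReal.conjExponent, ?_, ?_⟩
  · simpa using ENNReal.ofReal_le_ofReal h.symm.lt.le
  · rwa [ENNReal.toReal_ofReal h.symm.nonneg]

theorem tendsto_rpow_smul_zero {X : Type*} [NormedAddCommGroup X] [NormedSpace ℝ X]
    {ε : ℕ → ℝ} (hε_pos : ∀ n, 0 < ε n) (hε : Tendsto ε atTop (𝓝 0)) {γ : ℝ} (hγ : 1 < γ)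
    {y : ℕ → X} {C : ℝ} (hy : ∀ n, ‖y n‖ ≤ C) :
    Tendsto (fun n => ε n ^ γ • (ε n)⁻¹ • y n) atTop (𝓝 0) := by
  have h0 : 0 < γ - 1 := sub_pos.2 hγ
  have hpow : Tendsto (fun n => ε n ^ (γ - 1) * C) atTop (𝓝 0) := by
    simpa [Real.zero_rpow h0.ne'] using (hε.rpow_const (Or.inr h0.le)).mul_const C
  refine squeeze_zero_norm (fun n => ?_) hpow
  rw [smul_smul, ← div_eq_mul_inv, ← Real.rpow_sub_one (hε_pos n).ne', norm_smul,
    Real.norm_of_nonneg (Real.rpow_nonneg (hε_pos n).le _)]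
  exact mul_le_mul_of_nonneg_left (hy n) (Real.rpow_nonneg (hε_pos n).le _)

theorem tendsto_zero_of_norm_rpow_smul_le {X : Type*} [NormedAddCommGroup X] [NormedSpace ℝ X]
    {ε : ℕ → ℝ} (hε_pos : ∀ n, 0 < ε n) (hε : Tendsto ε atTop (𝓝 0)) {γ : ℝ} (hγ : γ < 1)
    {y : ℕ → X} {C : ℝ} (hy : ∀ n, ‖ε n ^ γ • (ε n)⁻¹ • y n‖ ≤ C) :
    Tendsto y atTop (𝓝 0) := by
  -- The exponent `2 - γ > 1` undoes the given scaling: `ε^(2-γ) ε⁻¹ · ε^γ ε⁻¹ = 1`.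
  refine (tendsto_rpow_smul_zero hε_pos hε (γ := 2 - γ) (by linarith) hy).congr fun n => ?_
  have h : ε n ^ (2 - γ) * (ε n)⁻¹ * ε n ^ γ * (ε n)⁻¹ = 1 := by
    have h2 : ε n ^ (2 - γ) * ε n ^ γ = ε n ^ 2 := by
      rw [← Real.rpow_add (hε_pos n), sub_add_cancel, Real.rpow_two]
    have := (hε_pos n).ne'
    calc _ = ε n ^ (2 - γ) * ε n ^ γ * (ε n)⁻¹ * (ε n)⁻¹ := by ring
      _ = 1 := by rw [h2]; field_simp
  rw [smul_smul, smul_smul, smul_smul, h, one_smul]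

variable {d : ℕ} {Ω : Type*} [MeasurableSpace Ω] {P : Measure Ω} {p : ℝ≥0∞} [Fact (1 ≤ p)]
  [IsProbabilityMeasure P] [AddAction (Lattice d) Ω] [MeasurableConstVAdd (Lattice d) Ω]
  [VAddInvariantMeasure (Lattice d) Ω P]

theorem weakTwoScale_discreteDeriv {ε : ℕ → ℝ} (hε : ∀ n, 0 < ε n) (i : Fin d)
    {u : ℕ → Ω × Lattice d → ℝ} (hu : ∀ n, MemLp (unfold (ε n) (u n)) p (P.prod volume))
    (c : ℕ → ℝ) {W : LpField d P p}
    (hW : WeakTendsto (fun n => c n • (ε n)⁻¹ • (unitFieldShift d P p i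
      (axisShift (fieldTranslation P p) (ε n) i ((hu n).toLp _)) - (hu n).toLp _)) W) :
    WeakTwoScale P p ε (fun n => c n • discreteDeriv (ε n) i (u n)) W := by
  choose h heq using fun n => exists_memLp_unfold_discreteDeriv (hε n) i (hu n) (c n)
  refine ⟨h, fun ℓ => (hW ℓ).congr fun n => ?_⟩
  exact congrArg ℓ (heq n).symm

end Assembly

end StochasticUnfolding

end

/-! ### The four regimes of `γ` -/

theorem proposition3p5 {Ω : Type*} [MeasurableSpace Ω] {d : ℕ} [AddAction (Lattice d) Ω]
    [MeasurableConstVAdd (Lattice d) Ω] (P : Measure Ω) [IsProbabilityMeasure P]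
    [VAddInvariantMeasure (Lattice d) Ω P] [IsSeparable P]
    (p : ℝ≥0∞) [Fact (1 ≤ p)] (hp_one : 1 < p) (hp_top : p ≠ ∞)
    (γ : ℝ) (hγ : 0 ≤ γ)
    (ε : ℕ → ℝ) (hε_pos : ∀ n, 0 < ε n) (hε : Tendsto ε atTop (𝓝 0))
    (u : ℕ → Ω × Lattice d → ℝ)
    (hu : ∀ n, MemLp (u n) p (P.prod (latticeMeasure d (ε n))))
    (hbound : limsup (fun n => energy P p γ (ε n) (u n)) atTop < ∞) :
    (γ = 0 →
      ∃ (U : LpField d P p) (gradU χ : Fin d → LpField d P p),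
        (U, gradU) ∈ invTensorSobolev d P p ∧ χ ∈ potTensorLp d P p ∧
        ∃ k : ℕ → ℕ, StrictMono k ∧
          WeakTwoScale P p (ε ∘ k) (u ∘ k) U ∧
          ∀ i, WeakTwoScale P p (ε ∘ k)
            (fun n => discreteDeriv (ε (k n)) i (u (k n))) (gradU i + χ i)) ∧
    (0 < γ → γ < 1 →
      ∃ (U : LpField d P p) (χ : Fin d → LpField d P p),
        U ∈ invTensorLp d P p ∧ χ ∈ potTensorLp d P p ∧
        ∃ k : ℕ → ℕ, StrictMono k ∧
          WeakTwoScale P p (ε ∘ k) (u ∘ k) U ∧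
          ∀ i, WeakTwoScale P p (ε ∘ k)
            (fun n => ε (k n) ^ γ • discreteDeriv (ε (k n)) i (u (k n))) (χ i)) ∧
    (γ = 1 →
      ∃ (U : LpField d P p) (k : ℕ → ℕ), StrictMono k ∧
        WeakTwoScale P p (ε ∘ k) (u ∘ k) U ∧
        ∀ i, WeakTwoScale P p (ε ∘ k)
          (fun n => ε (k n) • discreteDeriv (ε (k n)) i (u (k n)))
          (horizontalDerivField P p i U)) ∧
    (1 < γ →
      ∃ (U : LpField d P p) (k : ℕ → ℕ), StrictMono k ∧
        WeakTwoScale P p (ε ∘ k) (u ∘ k) U ∧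
        ∀ i, WeakTwoScale P p (ε ∘ k)
          (fun n => ε (k n) ^ γ • discreteDeriv (ε (k n)) i (u (k n))) 0) := by
  obtain ⟨q, hq1, hpq⟩ := exists_holderConjugate hp_one hp_top
  have : Fact (1 ≤ q) := ⟨hq1⟩
  obtain ⟨hXΩ, hX⟩ := hasWeakCompactness_field (P := P) (d := d) hp_top hpq
  have hτ := isTranslationGroup_fieldTranslation (d := d) (P := P) hp_top hpq
  have hSτ := unitFieldShift_commute_fieldTranslation (d := d) (P := P) (p := p)
  obtain ⟨k, U, W, C, hk, hvC, hwC, hU, hW⟩ := exists_weak_limits hp_top hX hε_pos hu hbound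
  have hεk : Tendsto (fun n => ε (k n)) atTop (𝓝 0) := hε.comp hk.tendsto_atTop
  have hεk_pos : ∀ n, 0 < ε (k n) := fun n => hε_pos (k n)
  have hU2 : WeakTwoScale P p (ε ∘ k) (u ∘ k) U :=
    ⟨fun n => memLp_unfold (hε_pos (k n)) (hu (k n)), hU⟩
  have hW2 : ∀ i, WeakTwoScale P p (ε ∘ k)
      (fun n => ε (k n) ^ γ • discreteDeriv (ε (k n)) i (u (k n))) (W i) := fun i =>
    weakTwoScale_discreteDeriv hεk_pos i
      (fun n => memLp_unfold (hε_pos (k n)) (hu (k n))) (fun n => ε (k n) ^ γ) (hW i)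
  -- For `γ < 1` the bound makes `S_i τ v - v` vanish in norm, while its weak limit is `S_i U - U`.
  have hfix : γ < 1 → U ∈ fixedSpace (unitFieldShift d P p) := fun h => mem_fixedSpace.2 fun i =>
    (sub_eq_zero.1 (weakLimit_shift_sub hτ hSτ hεk_pos hεk hvC hU i
      (.of_tendsto (tendsto_zero_of_norm_rpow_smul_le hεk_pos hεk h (hwC i)))).symm)
  refine ⟨?_, fun hγ0 hγ1 => ?_, ?_, fun hγ1 => ⟨U, k, hk, hU2, fun i => ?_⟩⟩
  · rintro rfl
    simp only [Real.rpow_zero, one_smul] at hW hW2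
    have hUS := hfix one_pos
    obtain ⟨G, -, hG, hℓ⟩ := exists_gradient_splitting hX unitFieldShift_commute
      norm_unitFieldShift_le hτ hSτ hεk_pos hεk hvC hU hUS hW
    refine ⟨U, G, fun i => W i - G i,
      mem_invTensorSobolev hp_top hpq (fixedSpace_le_invTensorLp hp_top hpq hXΩ hUS) hG,
      mem_potTensorLp hp_top hpq hℓ, k, hk, hU2, fun i => ?_⟩
    rw [add_sub_cancel]
    exact hW2 i
  · have hUS := hfix hγ1
    have hpow : Tendsto (fun n => ε (k n) ^ γ) atTop (𝓝 0) := by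
      simpa [Real.zero_rpow hγ0.ne'] using hεk.rpow_const (Or.inr hγ0.le)
    exact ⟨U, W, fixedSpace_le_invTensorLp hp_top hpq hXΩ hUS,
      mem_potTensorLp hp_top hpq fun ℓ hℓ =>
        sum_dual_eq_zero hτ hSτ hεk_pos hεk hvC hU hUS hpow hW hℓ, k, hk, hU2, hW2⟩
  · rintro rfl
    simp only [Real.rpow_one] at hW hW2
    refine ⟨U, k, hk, hU2, fun i => ?_⟩
    have hWi : W i = horizontalDerivField P p i U :=
      weakLimit_shift_sub hτ hSτ hεk_pos hεk hvC hU i (by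
        simpa only [smul_inv_smul₀ (hεk_pos _).ne'] using hW i)
    rw [← hWi]
    exact hW2 i
  · have hWi : W i = 0 := (hW i).unique (.of_tendsto
      -- Both terms of `S_i τ v - v` have norm at most `C`.
      (tendsto_rpow_smul_zero hεk_pos hεk hγ1 (C := 2 * C) fun n => by
        refine (norm_sub_le _ _).trans ?_
        have h1 := (ContinuousLinearMap.le_of_opNorm_le _ (norm_unitFieldShift_le i)
          (axisShift (fieldTranslation P p) (ε (k n)) i
            ((memLp_unfold (hε_pos (k n)) (hu (k n))).toLp _))).trans
            ((one_mul _).trans_le (hτ.norm_le _ _))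
        linarith [hvC n]))
    rw [← hWi]
    exact hW2 i
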